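/- Let $H$ be a finite graph with $r$ distinct labelled root vertices $1,\dots,r$, let $G$ be the subgraph of $H$ induced by the roots, and assume $e_H>e_G$. For a tuple $\mathbf x=(x_1,\dots,x_r)$ of distinct vertices of $[n]$ (a "root"), a $(G,H)$-extension of $\mathbf x$ is a (not necessarily induced) copy of the graph $H_G=(V(H),E(H)\setminus E(G))$ in which each root vertex $j$ is mapped onto $x_j$. Let $X_{\mathbf x}=X_{G,H}(\mathbf x)$ be the number of $(G,H)$-extensions of $\mathbf x$ in the binomial random graph $\mathbb G_{n,p}$; its mean $\mu=\mu_{G,H}=\mathbb E X_{\mathbf x}$ does not depend on $\mathbf x$. For a subgraph $G\subseteq J\subseteq H$ define $\mu_{G,J}$ in the same way with $J$ in place of $H$, and let $$\Phi=\Phi_{G,H}=\min_{G\subseteq J\subseteq H,\ e_J>e_G}\mu_{G,J}.$$ Then for all $p=p(n)\in[0,1]$ and $\varepsilon=\varepsilon(n)\in(0,1]$ such that $1-p=\Omega(1)$ (that is, $1-p(n)\ge c$ for some constant $c>0$ and all large $n$) and $\Phi\to\infty$ as $n\to\infty$, $$\lim_{n\to\infty}\Pr\Bigl(\max_{\mathbf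 x}|X_{\mathbf x}-\mu|<\varepsilon\mu\Bigr)=\begin{cases}0&\text{if }\varepsilon^2\Phi\to0,\\ 1&\text{if }\varepsilon^2\Phi=n^{\Omega(1)},\end{cases}$$ where the maximum is over all roots $\mathbf x$, and $\varepsilon^2\Phi=n^{\Omega(1)}$ means that there is a constant $c>0$ such that $\varepsilon(n)^2\Phi\ge n^{c}$ for all large $n$. -/

import Mathlib

open MeasureTheory ProbabilityTheory Filter Topology
open scoped SimpleGraph

universe u

/-- A rooted graph `(G, H)`: a graph `H = graph` with `r` distinct labelled root vertices
`root 0, …, root (r - 1)`; `G` is the subgraph of `H` induced by the roots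
(`RootedGraph.rootGraph`). -/
structure RootedGraph (V : Type u) (r : ℕ) where
  /-- the graph `H` -/
  graph : SimpleGraph V
  /-- the labelled root vertices -/
  root : Fin r ↪ V

namespace RootedGraph

/-- The subgraph `G` of `H` induced by the root vertices. -/
def rootGraph {V : Type u} {r : ℕ} (R : RootedGraph V r) : R.graph.Subgraph :=
  (⊤ : R.graph.Subgraph).induce (Set.range R.root)

/-- The graph `H_G = (V(H), E(H) \ E(G))`. -/
def extGraph {V : Type u} {r : ℕ} (R : RootedGraph V r) : SimpleGraph V :=
  R.graph.deleteEdges R.rootGraph.edgeSet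

/-- The subgraph `F` of `Γ` is a `(G, H)`-extension of the root tuple `x`: it is a copy of `H_G`
in which the `j`-th root vertex is mapped onto `x j`. -/
def IsExtension {V : Type u} {r : ℕ} (R : RootedGraph V r) {W : Type*} {Γ : SimpleGraph W}
    (x : Fin r ↪ W) (F : Γ.Subgraph) : Prop :=
  ∃ φ : R.extGraph ≃g F.coe, ∀ j : Fin r, (φ (R.root j) : W) = x j

/-- The number `X_x` of `(G, H)`-extensions of `x` in `Γ`. -/
noncomputable def extCount {V : Type u} {r : ℕ} (R : RootedGraph V r) {W : Type*}
    (Γ : SimpleGraph W) (x : Fin r ↪ W) : ℕ :=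
  Set.ncard {F : Γ.Subgraph | R.IsExtension x F}

/-- The mean `μ = E X_x` in the binomial random graph `G(n, p)`, evaluated at the root tuple
consisting of the first `r` vertices (it does not depend on the tuple: see `integral_extCount`);
it is `0` if `n < r`, when there are no root tuples. -/
noncomputable def mean {V : Type u} {r : ℕ} (R : RootedGraph V r) (n : ℕ) (p : unitInterval) : ℝ :=
  if h : r ≤ n then
    ∫ Γ : SimpleGraph (Fin n), (R.extCount Γ (Fin.castLEEmb h) : ℝ) ∂G(Fin n, p)
  else 0

/-- The rooted graph `(G, J)`, for a subgraph `G ⊆ J ⊆ H`. -/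
def restrict {V : Type u} {r : ℕ} (R : RootedGraph V r) (J : R.graph.Subgraph)
    (hJ : R.rootGraph ≤ J) : RootedGraph J.verts r where
  graph := J.coe
  root := ⟨fun j => ⟨R.root j, hJ.1 ⟨j, rfl⟩⟩,
    fun _ _ h => R.root.injective (congrArg Subtype.val h)⟩

/-- `Φ = min μ_{G,J}`, the minimum being over all subgraphs `G ⊆ J ⊆ H` with `e_J > e_G`. -/
noncomputable def Phi {V : Type u} {r : ℕ} (R : RootedGraph V r) (n : ℕ) (p : unitInterval) : ℝ :=
  ⨅ J : {J : R.graph.Subgraph //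
      R.rootGraph ≤ J ∧ R.rootGraph.edgeSet.ncard < J.edgeSet.ncard},
    (R.restrict J.1 J.2.1).mean n p

theorem IsExtension.map_iso {V : Type u} {r : ℕ} {R : RootedGraph V r} {W W' : Type*}
    {Γ : SimpleGraph W} {Γ' : SimpleGraph W'} (e : Γ ≃g Γ') {x : Fin r ↪ W} {y : Fin r ↪ W'}
    (hxy : ∀ j, e (x j) = y j) {F : Γ.Subgraph} (hF : R.IsExtension x F) :
    R.IsExtension y (F.map e.toHom) := by
  obtain ⟨φ, hφ⟩ := hF
  let f : F.verts ≃ (F.map e.toHom).verts := e.toEquiv.image F.verts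
  have hf : ∀ v : F.verts, ((f v : (F.map e.toHom).verts) : W') = e v := fun v => rfl
  refine ⟨φ.trans ⟨f, ?_⟩, fun j => ?_⟩
  · intro a b
    simp only [SimpleGraph.Subgraph.coe_adj, SimpleGraph.Subgraph.map_adj, hf]
    constructor
    · rintro ⟨a', b', h, ha, hb⟩
      have ha' : a' = a := e.injective ha
      have hb' : b' = b := e.injective hb
      exact ha' ▸ hb' ▸ h
    · intro h
      exact ⟨_, _, h, rfl, rfl⟩
  · change e (φ (R.root j) : W) = y j
    rw [hφ, hxy]

theorem extCount_le_of_iso {V : Type u} {r : ℕ} (R : RootedGraph V r) {W W' : Type*}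
    [Finite W'] {Γ : SimpleGraph W} {Γ' : SimpleGraph W'} (e : Γ ≃g Γ')
    {x : Fin r ↪ W} {y : Fin r ↪ W'} (hxy : ∀ j, e (x j) = y j) :
    R.extCount Γ x ≤ R.extCount Γ' y := by
  refine Set.ncard_le_ncard_of_injOn (fun F => F.map e.toHom)
    (fun F hF => IsExtension.map_iso e hxy hF) ?_ (Set.toFinite _)
  intro F _ F' _ h
  have key : ∀ F : Γ.Subgraph, (F.map e.toHom).map e.symm.toHom = F := by
    intro F
    rw [← SimpleGraph.Subgraph.map_comp]
    have : e.symm.toHom.comp e.toHom = SimpleGraph.Hom.id := by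
      ext v; exact e.symm_apply_apply v
    rw [this, SimpleGraph.Subgraph.map_id]
  rw [← key F, ← key F']
  exact congrArg (fun F => SimpleGraph.Subgraph.map e.symm.toHom F) h

/-- `E X_x` does not depend on the root tuple `x`. -/
theorem integral_extCount {V : Type u} {r : ℕ} (R : RootedGraph V r) (n : ℕ) (p : unitInterval)
    (x : Fin r ↪ Fin n) :
    ∫ Γ : SimpleGraph (Fin n), (R.extCount Γ x : ℝ) ∂G(Fin n, p) = R.mean n p := by
  classical
  have hr : r ≤ n := by simpa using Fintype.card_le_of_embedding x
  rw [mean, dif_pos hr]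
  obtain ⟨σ, hσ⟩ := Equiv.Perm.exists_extending_pair x (Fin.castLEEmb hr) x.injective
    (Fin.castLEEmb hr).injective
  have hσ' : ∀ j, σ (x j) = Fin.castLEEmb hr j := fun j => by
    exact hσ j
  have : MeasurableSingletonClass (SimpleGraph (Fin n)) := ⟨fun Γ => by
    have h := (Set.toFinite
      ({Γ.edgeSet} : Set (Set (Sym2 (Fin n))))).measurableSet.preimage
      (SimpleGraph.measurable_edgeSet (V := Fin n))
    convert h using 1
    ext Γ'
    simp⟩
  rw [integral_fintype (.of_finite), integral_fintype (.of_finite)]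
  refine Fintype.sum_equiv (Equiv.simpleGraph σ) _ _ fun Γ => ?_
  let e : Γ ≃g Equiv.simpleGraph σ Γ :=
    ⟨σ, by intro a b; simp [Equiv.simpleGraph]⟩
  have hc : R.extCount Γ x = R.extCount (Equiv.simpleGraph σ Γ) (Fin.castLEEmb hr) :=
    le_antisymm (R.extCount_le_of_iso e hσ')
      (R.extCount_le_of_iso e.symm fun j => by
        rw [← hσ' j]; exact e.symm_apply_apply (x j))
  have hm : Γ.edgeSet.ncard = (Equiv.simpleGraph σ Γ).edgeSet.ncard :=
    Nat.card_congr e.mapEdgeSet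
  rw [hc, measureReal_def, measureReal_def, SimpleGraph.binomialRandom_singleton,
    SimpleGraph.binomialRandom_singleton, hm]

end RootedGraph

/-! Fix a root x and let a be the number of automorphisms of H_G fixing the roots. Then W = a(X_x −
μ) is a sum, over the injections φ of V(H) sending the roots to x, of centred indicators of A_φ ⊆ S.
Here S is a binomial random set of pairs and A_φ is the image of the edges of H_G
(`centredSum_extImage`). Write m = aμ. Everything rests on one overlap estimate,
`sum_meetWeight_extImage_le`: once a bounded set U of pairs is present, the expected number of A_φ ⊆
S that meet U is at most D = O(m/Φ). Indeed, forcing a nonempty edge set F into U loses a factor of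
order n^(new vertices) p^|F|, and this is at least Φ.

1-statement. In the expansion of E W^(2k) only tuples in which every set meets another one survive,
and each set that meets earlier ones costs D instead of m. Hence E W^(2k) = O((m²/Φ)^k)
(`subsetExp_centredSum_pow_le`), and Markov's inequality gives Pr(|X_x − μ| ≥ εμ) = O((ε²Φ)^(−k)).
If ε²Φ is at least a power of n, a large constant k beats the at most n^r roots in a union bound.

0-statement. A single root suffices. Pairs of embeddings that agree on the minimising J show that σ²
= E W² is of order at least m²/Φ, as 1 − p is bounded below (`exists_le_variance_mul_Phi`). Stein's
method gives E[W f(W)] ≈ σ² E f'(W), with an error of order mD² times a smoothness constant of f.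
For an arctangent f of scale s this yields Pr(|W| ≤ s) = O(s/σ + mD²/(sσ²))
(`subsetExp_abs_centredSum_le_le`). With s = δσ the second term is O(1/(δ√Φ)), and εm is eventually
below δσ because ε²Φ → 0. -/

/-! ### Expectation over a binomial random subset -/

section SubsetExp

/-- Exchange the parts of two sets inside and outside of `A`. -/
theorem swap_involutive {E : Type*} [DecidableEq E] (A : Finset E) : Function.Involutive
    fun q : Finset E × Finset E => ((q.1 ∩ A) ∪ (q.2 \ A), (q.2 ∩ A) ∪ (q.1 \ A)) := by
  rintro ⟨S, T⟩
  ext e <;> simp <;> tauto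

variable {E : Type*} [Fintype E] [DecidableEq E]

/-- The probability that the binomial random subset of `E` with density `p` equals `S`. -/
noncomputable def subsetWeight (p : ℝ) (S : Finset E) : ℝ :=
  ∏ e : E, if e ∈ S then p else 1 - p

/-- The expectation of `f` over the binomial random subset of `E` with density `p`. -/
noncomputable def subsetExp (p : ℝ) (f : Finset E → ℝ) : ℝ :=
  ∑ S : Finset E, subsetWeight p S * f S

/-- Total mass, inclusion probabilities and the weights of fibres are all instances of this
expansion, for suitable `x` and `y`. -/
theorem sum_prod_mem (x y : E → ℝ) :
    ∑ S : Finset E, ∏ e : E, (if e ∈ S then x e else y e) = ∏ e : E, (x e + y e) := by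
  rw [Finset.prod_add, Finset.powerset_univ]
  refine Finset.sum_congr rfl fun S _ => ?_
  rw [Finset.prod_ite]
  congr 1
  · exact Finset.prod_congr (by ext; simp) fun _ _ => rfl
  · exact Finset.prod_congr (by ext; simp) fun _ _ => rfl

theorem subsetWeight_nonneg {p : ℝ} (h0 : 0 ≤ p) (h1 : p ≤ 1) (S : Finset E) :
    0 ≤ subsetWeight p S :=
  Finset.prod_nonneg fun e _ => by split_ifs <;> linarith

theorem subsetExp_const (p c : ℝ) : subsetExp (E := E) p (fun _ => c) = c := by
  rw [subsetExp, ← Finset.sum_mul]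
  have : ∑ S : Finset E, subsetWeight p S = 1 := by
    simp only [subsetWeight]
    rw [sum_prod_mem (fun _ => p) (fun _ => 1 - p)]
    simp
  rw [this, one_mul]

theorem subsetExp_add (p : ℝ) (f g : Finset E → ℝ) :
    subsetExp p (fun S => f S + g S) = subsetExp p f + subsetExp p g := by
  simp only [subsetExp, mul_add, Finset.sum_add_distrib]

theorem subsetExp_sub (p : ℝ) (f g : Finset E → ℝ) :
    subsetExp p (fun S => f S - g S) = subsetExp p f - subsetExp p g := by
  simp only [subsetExp, mul_sub, Finset.sum_sub_distrib]

theorem subsetExp_const_mul (p c : ℝ) (f : Finset E → ℝ) :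
    subsetExp p (fun S => c * f S) = c * subsetExp p f := by
  rw [subsetExp, subsetExp, Finset.mul_sum]
  exact Finset.sum_congr rfl fun _ _ => by ring

theorem subsetExp_mul_const (p c : ℝ) (f : Finset E → ℝ) :
    subsetExp p (fun S => f S * c) = subsetExp p f * c := by
  simp only [mul_comm _ c, subsetExp_const_mul]

theorem subsetExp_sum (p : ℝ) {κ : Type*} (s : Finset κ) (f : κ → Finset E → ℝ) :
    subsetExp p (fun S => ∑ i ∈ s, f i S) = ∑ i ∈ s, subsetExp p (f i) := by
  simp only [subsetExp, Finset.mul_sum]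
  exact Finset.sum_comm

theorem subsetExp_mono {p : ℝ} (h0 : 0 ≤ p) (h1 : p ≤ 1) {f g : Finset E → ℝ}
    (h : ∀ S, f S ≤ g S) : subsetExp p f ≤ subsetExp p g :=
  Finset.sum_le_sum fun S _ => mul_le_mul_of_nonneg_left (h S) (subsetWeight_nonneg h0 h1 S)

theorem subsetExp_nonneg {p : ℝ} (h0 : 0 ≤ p) (h1 : p ≤ 1) {f : Finset E → ℝ}
    (h : ∀ S, 0 ≤ f S) : 0 ≤ subsetExp p f :=
  Finset.sum_nonneg fun S _ => mul_nonneg (subsetWeight_nonneg h0 h1 S) (h S)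

theorem abs_subsetExp_le {p : ℝ} (h0 : 0 ≤ p) (h1 : p ≤ 1) (f : Finset E → ℝ) :
    |subsetExp p f| ≤ subsetExp p (fun S => |f S|) := by
  refine (Finset.abs_sum_le_sum_abs _ _).trans (le_of_eq ?_)
  exact Finset.sum_congr rfl fun S _ => by rw [abs_mul, abs_of_nonneg (subsetWeight_nonneg h0 h1 S)]

/-- Write both sides as sums over two independent copies S, T. Exchanging the parts of S and T
outside `A` preserves the product weight and turns f(S)g(S) into f(S')g(T'). -/
theorem subsetExp_mul_of_indep (p : ℝ) (A : Finset E) {f g : Finset E → ℝ}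
    (hf : ∀ S, f (S ∩ A) = f S) (hg : ∀ S, g (S \ A) = g S) :
    subsetExp p (fun S => f S * g S) = subsetExp p f * subsetExp p g := by
  have key : subsetExp p f * subsetExp p g =
      ∑ q : Finset E × Finset E, subsetWeight p q.1 * subsetWeight p q.2 * (f q.1 * g q.2) := by
    rw [subsetExp, subsetExp, Finset.sum_mul_sum, ← Finset.univ_product_univ, Finset.sum_product]
    exact Finset.sum_congr rfl fun _ _ => Finset.sum_congr rfl fun _ _ => by ring
  have key2 : subsetExp p (fun S => f S * g S) * subsetExp (E := E) p (fun _ => 1) =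
      ∑ q : Finset E × Finset E, subsetWeight p q.1 * subsetWeight p q.2 * (f q.1 * g q.1) := by
    rw [subsetExp, subsetExp, Finset.sum_mul_sum, ← Finset.univ_product_univ, Finset.sum_product]
    exact Finset.sum_congr rfl fun _ _ => Finset.sum_congr rfl fun _ _ => by ring
  rw [subsetExp_const, mul_one] at key2
  rw [key, key2]
  refine Fintype.sum_equiv (swap_involutive A).toPerm _ _ ?_
  rintro ⟨S, T⟩
  simp only [Function.Involutive.coe_toPerm]
  have hw : subsetWeight p S * subsetWeight p T =
      subsetWeight p ((S ∩ A) ∪ (T \ A)) * subsetWeight p ((T ∩ A) ∪ (S \ A)) := by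
    simp only [subsetWeight, ← Finset.prod_mul_distrib]
    refine Finset.prod_congr rfl fun e _ => ?_
    by_cases he : e ∈ A <;> simp [he, mul_comm]
  have h1 : f ((S ∩ A) ∪ (T \ A)) = f S := by
    rw [← hf, ← hf S]; congr 1; ext e; simp; tauto
  have h2 : g ((T ∩ A) ∪ (S \ A)) = g S := by
    rw [← hg, ← hg S]; congr 1; ext e; simp; tauto
  rw [hw, h1, h2]

theorem subsetExp_subset (p : ℝ) (A : Finset E) :
    subsetExp p (fun S => if A ⊆ S then (1 : ℝ) else 0) = p ^ A.card := by
  -- Giving weight 0 to the absence of an element of `A` kills every S that does not contain `A`.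
  have h := sum_prod_mem (fun _ : E => p) (fun e => if e ∈ A then 0 else 1 - p)
  have h2 : ∏ e : E, (p + if e ∈ A then 0 else 1 - p) = p ^ A.card := by
    have : ∀ e : E, (p + if e ∈ A then 0 else 1 - p) = if e ∈ A then p else 1 := by
      intro e; split_ifs <;> ring
    simp only [this]
    rw [Finset.prod_ite_mem, Finset.univ_inter, Finset.prod_const]
  rw [← h2, ← h]
  refine Finset.sum_congr rfl fun S _ => ?_
  simp only [subsetWeight]
  split_ifs with hA
  · rw [mul_one]
    refine Finset.prod_congr rfl fun e _ => ?_
    by_cases heS : e ∈ S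
    · simp [heS]
    · simp [heS, show e ∉ A from fun h => heS (hA h)]
  · obtain ⟨e, heA, heS⟩ := Finset.not_subset.1 hA
    rw [mul_zero, eq_comm]
    exact Finset.prod_eq_zero (Finset.mem_univ e) (by simp [heA, heS])

theorem sq_subsetExp_le {p : ℝ} (h0 : 0 ≤ p) (h1 : p ≤ 1) (f : Finset E → ℝ) :
    subsetExp p f ^ 2 ≤ subsetExp p (fun S => f S ^ 2) := by
  have h := subsetExp_nonneg (E := E) h0 h1 (f := fun S => (f S - subsetExp p f) ^ 2)
    fun S => sq_nonneg _
  have e : (fun S => (f S - subsetExp p f) ^ 2) =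
      fun S => (f S ^ 2 - 2 * subsetExp p f * f S) + subsetExp p f ^ 2 := by
    ext S; ring
  rw [e, subsetExp_add, subsetExp_sub, subsetExp_const_mul, subsetExp_const] at h
  nlinarith

/-- Markov's inequality for even powers. -/
theorem subsetExp_abs_ge_le {p : ℝ} (h0 : 0 ≤ p) (h1 : p ≤ 1) (f : Finset E → ℝ) {a : ℝ}
    (ha : 0 < a) (k : ℕ) :
    subsetExp p (fun S => if a ≤ |f S| then (1 : ℝ) else 0) ≤
      subsetExp p (fun S => f S ^ (2 * k)) / a ^ (2 * k) := by
  rw [div_eq_inv_mul, ← subsetExp_const_mul]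
  refine subsetExp_mono h0 h1 fun S => ?_
  have hnn : 0 ≤ f S ^ (2 * k) := by rw [pow_mul]; positivity
  split_ifs with h
  · rw [← div_eq_inv_mul, le_div_iff₀ (by positivity), one_mul]
    calc a ^ (2 * k) ≤ |f S| ^ (2 * k) := pow_le_pow_left₀ ha.le h _
      _ = f S ^ (2 * k) := by rw [pow_mul, sq_abs, ← pow_mul]
  · positivity

end SubsetExp

/-! ### Sums of centred indicators of `A i ⊆ S` -/

section Centred

variable {E ι : Type*} [DecidableEq E]

/-- The indicator of `A i ⊆ S`, centred. -/
noncomputable def centred (p : ℝ) (A : ι → Finset E) (i : ι) (S : Finset E) : ℝ :=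
  (if A i ⊆ S then 1 else 0) - p ^ (A i).card

variable (p : ℝ) (A : ι → Finset E)

theorem centred_inter (i : ι) {B : Finset E} (h : A i ⊆ B) (S : Finset E) :
    centred p A i (S ∩ B) = centred p A i S := by
  simp only [centred, Finset.subset_inter_iff, h, and_true]

theorem centred_sdiff (i : ι) {B : Finset E} (h : Disjoint (A i) B) (S : Finset E) :
    centred p A i (S \ B) = centred p A i S := by
  simp only [centred, Finset.subset_sdiff, h, and_true]

variable [Fintype E]

theorem subsetExp_centred (i : ι) : subsetExp p (centred p A i) = 0 := by
  have : subsetExp p (centred p A i) =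
    subsetExp p (fun S => (if A i ⊆ S then (1 : ℝ) else 0) - p ^ (A i).card) := rfl
  rw [this, subsetExp_sub, subsetExp_subset, subsetExp_const, sub_self]

variable {p}

/-- Bound each centred indicator by indicator plus mean and expand into 2^|s| terms. Each term is p
raised to the size of a union plus further sizes, an exponent no smaller than the size of the full
union. -/
theorem subsetExp_abs_prod_centred_le (h0 : 0 ≤ p) (h1 : p ≤ 1) 
    {κ : Type*} [DecidableEq κ] (s : Finset κ) (t : κ → ι) :
    subsetExp p (fun S => |∏ j ∈ s, centred p A (t j) S|) ≤
      2 ^ s.card * p ^ (s.biUnion fun j => A (t j)).card := by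
  have hb : ∀ S, |∏ j ∈ s, centred p A (t j) S| ≤
      ∏ j ∈ s, ((if A (t j) ⊆ S then 1 else 0) + p ^ (A (t j)).card) := by
    intro S
    rw [Finset.abs_prod]
    refine Finset.prod_le_prod (fun _ _ => abs_nonneg _) fun j _ => ?_
    have : 0 ≤ p ^ (A (t j)).card := by positivity
    rw [centred, abs_le]
    split_ifs <;> constructor <;> linarith
  refine (subsetExp_mono h0 h1 hb).trans ?_
  simp only [Finset.prod_add]
  rw [subsetExp_sum]
  have hone : ∀ u ∈ s.powerset, subsetExp p (fun S => (∏ j ∈ u, if A (t j) ⊆ S then (1 : ℝ) else 0) *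
      ∏ j ∈ s \ u, p ^ (A (t j)).card) ≤ p ^ (s.biUnion fun j => A (t j)).card := by
    intro u hu
    rw [Finset.mem_powerset] at hu
    rw [subsetExp_mul_const]
    have : (fun S => ∏ j ∈ u, if A (t j) ⊆ S then (1 : ℝ) else 0) =
        fun S => if (u.biUnion fun j => A (t j)) ⊆ S then (1 : ℝ) else 0 := by
      ext S
      rw [Finset.prod_ite_zero]
      simp
    rw [this, subsetExp_subset, Finset.prod_pow_eq_pow_sum, ← pow_add]
    refine pow_le_pow_of_le_one h0 h1 ?_
    have hs : (s.biUnion fun j => A (t j)) ⊆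
        (u.biUnion fun j => A (t j)) ∪ ((s \ u).biUnion fun j => A (t j)) := by
      rw [← Finset.union_biUnion, Finset.union_sdiff_of_subset hu]
    exact (Finset.card_le_card hs).trans ((Finset.card_union_le _ _).trans
      (Nat.add_le_add_left Finset.card_biUnion_le _))
  refine (Finset.sum_le_sum hone).trans ?_
  rw [Finset.sum_const, Finset.card_powerset, nsmul_eq_mul]
  push_cast
  exact le_rfl

end Centred

/-! ### Moments of sums of centred indicators -/

section Moments

variable {E ι : Type*} [DecidableEq E]

/-- Each set of the tuple `A ∘ t` meets `U` or another set of the tuple. -/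
def Linked (A : ι → Finset E) (U : Finset E) {m : ℕ} (t : Fin m → ι) : Prop :=
  ∀ i, ¬ Disjoint (A (t i)) U ∨ ∃ j, j ≠ i ∧ ¬ Disjoint (A (t i)) (A (t j))

/-- Moving a removed set into `U` preserves linkedness; this is what allows induction on the length
of the tuple. -/
theorem Linked.tail {A : ι → Finset E} {U : Finset E} {m : ℕ} {a : ι} {t : Fin m → ι}
    (h : Linked A U (Fin.cons a t : Fin (m + 1) → ι)) : Linked A (U ∪ A a) t := by
  intro i
  rcases h i.succ with h | ⟨j, hj, h⟩
  · rw [Fin.cons_succ] at h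
    exact Or.inl fun hd => h (Finset.disjoint_union_right.1 hd).1
  · rw [Fin.cons_succ] at h
    induction j using Fin.cases with
    | zero => exact Or.inl fun hd => h (Finset.disjoint_union_right.1 hd).2
    | succ j => exact Or.inr ⟨j, fun e => hj (e ▸ rfl), by simpa using h⟩

theorem Linked.removeNth {A : ι → Finset E} {U : Finset E} {m : ℕ} {j : Fin (m + 1)} {b : ι}
    {t : Fin m → ι} (h : Linked A U (j.insertNth b t : Fin (m + 1) → ι)) :
    Linked A (U ∪ A b) t := by
  intro i
  rcases h (j.succAbove i) with h | ⟨l, hl, h⟩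
  · rw [Fin.insertNth_apply_succAbove] at h
    exact Or.inl fun hd => h (Finset.disjoint_union_right.1 hd).1
  · rw [Fin.insertNth_apply_succAbove] at h
    rcases Fin.eq_self_or_eq_succAbove j l with rfl | ⟨l, rfl⟩
    · rw [Fin.insertNth_apply_same] at h
      exact Or.inl fun hd => h (Finset.disjoint_union_right.1 hd).2
    · rw [Fin.insertNth_apply_succAbove] at h
      exact Or.inr ⟨l, fun e => hl (e ▸ rfl), h⟩

/-- The union of the sets of a tuple. -/
def tupleUnion (A : ι → Finset E) {m : ℕ} (t : Fin m → ι) : Finset E :=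
  Finset.univ.biUnion fun j => A (t j)

theorem card_tupleUnion_cons_sdiff (A : ι → Finset E) (U : Finset E) {m : ℕ} (a : ι)
    (t : Fin m → ι) :
    (tupleUnion A (Fin.cons a t : Fin (m + 1) → ι) \ U).card =
      (A a \ U).card + (tupleUnion A t \ (U ∪ A a)).card := by
  rw [← Finset.card_union_of_disjoint]
  · congr 1
    ext e
    simp only [tupleUnion, Finset.mem_sdiff, Finset.mem_biUnion, Finset.mem_univ, true_and,
      Finset.mem_union, Fin.exists_fin_succ, Fin.cons_zero, Fin.cons_succ]
    tauto
  · rw [Finset.disjoint_left]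
    intro e
    simp only [Finset.mem_sdiff, Finset.mem_union]
    tauto

theorem card_tupleUnion_insertNth_sdiff (A : ι → Finset E) (U : Finset E) {m : ℕ}
    (j : Fin (m + 1)) (b : ι) (t : Fin m → ι) :
    (tupleUnion A (j.insertNth b t : Fin (m + 1) → ι) \ U).card =
      (A b \ U).card + (tupleUnion A t \ (U ∪ A b)).card := by
  rw [← card_tupleUnion_cons_sdiff]
  congr 2
  ext e
  simp only [tupleUnion, Finset.mem_biUnion, Finset.mem_univ, true_and]
  refine (Fin.exists_iff_succAbove j).trans (Iff.trans ?_ Fin.exists_fin_succ.symm)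
  simp only [Fin.cons_zero, Fin.cons_succ, Fin.insertNth_apply_same,
    Fin.insertNth_apply_succAbove]

open Classical in
/-- The contribution of a linked tuple. -/
noncomputable def linkedWeight (p : ℝ) (A : ι → Finset E) (U : Finset E) {m : ℕ}
    (t : Fin m → ι) : ℝ :=
  if Linked A U t then p ^ (tupleUnion A t \ U).card else 0

theorem linkedWeight_nonneg {p : ℝ} (h0 : 0 ≤ p) (A : ι → Finset E) (U : Finset E) {m : ℕ}
    (t : Fin m → ι) : 0 ≤ linkedWeight p A U t := by
  rw [linkedWeight]; split_ifs <;> positivity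

theorem linkedWeight_cons_le {p : ℝ} (h0 : 0 ≤ p) (A : ι → Finset E) (U : Finset E)
    {m : ℕ} (a : ι) (t : Fin m → ι) :
    linkedWeight p A U (Fin.cons a t : Fin (m + 1) → ι) ≤
      p ^ (A a \ U).card * linkedWeight p A (U ∪ A a) t := by
  unfold linkedWeight
  split_ifs with h1 h2 h2
  · rw [card_tupleUnion_cons_sdiff, pow_add]
  · exact absurd h1.tail h2
  · positivity
  · simp

theorem linkedWeight_insertNth_le {p : ℝ} (h0 : 0 ≤ p) (A : ι → Finset E) (U : Finset E)
    {m : ℕ} (j : Fin (m + 1)) (b : ι) (t : Fin m → ι) :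
    linkedWeight p A U (j.insertNth b t : Fin (m + 1) → ι) ≤
      p ^ (A b \ U).card * linkedWeight p A (U ∪ A b) t := by
  unfold linkedWeight
  split_ifs with h1 h2 h2
  · rw [card_tupleUnion_insertNth_sdiff, pow_add]
  · exact absurd h1.removeNth h2
  · positivity
  · simp

open Classical in
/-- The contribution of `A i` if it meets `U`. -/
noncomputable def meetWeight (p : ℝ) (A : ι → Finset E) (U : Finset E) (i : ι) : ℝ :=
  if Disjoint (A i) U then 0 else p ^ (A i \ U).card

theorem meetWeight_nonneg {p : ℝ} (h0 : 0 ≤ p) (A : ι → Finset E) (U : Finset E) (i : ι) :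
    0 ≤ meetWeight p A U i := by
  rw [meetWeight]; split_ifs <;> positivity

/-- The first set of a linked tuple either meets `U`, or is disjoint from it and meets some later `A
(t j)`. The second case pays the full p^|A a|, but the partner `A (t j)` then meets the enlarged set
`U ∪ A a`, and `c j` records that gain. -/
theorem linkedWeight_cons_le_add {p : ℝ} (h0 : 0 ≤ p) (A : ι → Finset E) (U : Finset E)
    {m : ℕ} (a : ι) (t : Fin m → ι) (c : Fin m → ℝ) (hc : ∀ j, 0 ≤ c j)
    (hc' : ∀ j, ¬ Disjoint (A (t j)) (U ∪ A a) → linkedWeight p A (U ∪ A a) t ≤ c j) :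
    linkedWeight p A U (Fin.cons a t : Fin (m + 1) → ι) ≤
      meetWeight p A U a * linkedWeight p A (U ∪ A a) t + p ^ (A a).card * ∑ j, c j := by
  have hs : 0 ≤ ∑ j, c j := Finset.sum_nonneg fun j _ => hc j
  have hl := linkedWeight_nonneg h0 A (U ∪ A a) t
  have hm := meetWeight_nonneg h0 A U a
  by_cases hL : Linked A U (Fin.cons a t : Fin (m + 1) → ι)
  swap
  · rw [linkedWeight, if_neg hL]; positivity
  have h := linkedWeight_cons_le h0 A U a t
  by_cases hd : Disjoint (A a) U
  · rcases hL 0 with h1 | ⟨j, hj, h1⟩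
    · exact absurd hd (by simpa using h1)
    · induction j using Fin.cases with
      | zero => exact absurd rfl hj
      | succ j =>
        rw [Fin.cons_zero, Fin.cons_succ] at h1
        have h2 : ¬ Disjoint (A (t j)) (U ∪ A a) := fun h2 =>
          h1 (Finset.disjoint_union_right.1 h2).2.symm
        rw [Finset.sdiff_eq_self_of_disjoint hd] at h
        calc _ ≤ p ^ (A a).card * linkedWeight p A (U ∪ A a) t := h
          _ ≤ p ^ (A a).card * ∑ j, c j := by
            gcongr
            exact (hc' j h2).trans (Finset.single_le_sum (fun j _ => hc j) (Finset.mem_univ j))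
          _ ≤ _ := le_add_of_nonneg_left (by positivity)
  · rw [meetWeight, if_neg hd]
    exact h.trans (le_add_of_nonneg_right (by positivity))

/-- Some factor lives on a set disjoint from all the others, so it is independent of their product
and has mean zero. -/
theorem subsetExp_prod_centred_eq_zero [Fintype E] (p : ℝ) (A : ι → Finset E) {m : ℕ} (t : Fin m → ι)
    (ht : ¬ Linked A ∅ t) : subsetExp p (fun S => ∏ j, centred p A (t j) S) = 0 := by
  simp only [Linked, Finset.disjoint_empty_right, not_true_eq_false, false_or, not_forall,
    not_exists, not_and, not_not] at ht
  obtain ⟨i, hi⟩ := ht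
  have : (fun S => ∏ j, centred p A (t j) S) = fun S => centred p A (t i) S *
      ∏ j ∈ Finset.univ.erase i, centred p A (t j) S := by
    ext S
    exact (Finset.mul_prod_erase _ (fun j => centred p A (t j) S) (Finset.mem_univ i)).symm
  rw [this, subsetExp_mul_of_indep p (A (t i)), subsetExp_centred, zero_mul]
  · exact fun S => centred_inter p A (t i) subset_rfl S
  · exact fun S => Finset.prod_congr rfl fun j hj =>
      centred_sdiff p A (t j) (hi j (Finset.ne_of_mem_erase hj)).symm S

variable [Fintype ι]

/-- Let s_m bound the sum for tuples of length m, uniformly in `U`. Splitting on whether the first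
set meets `U` gives s_(m+2) ≤ D s_(m+1) + μ(m+1)D s_m. The conditions D ≤ b and μD ≤ b² make both
terms at most (m+1)! b^(m+2). The budget `K` leaves room for `U` to absorb the removed sets, of size
at most `k` each. -/
theorem sum_linkedWeight_le {p : ℝ} (h0 : 0 ≤ p) (A : ι → Finset E) {k K : ℕ}
    (hk : ∀ i, (A i).card ≤ k) {D μ b : ℝ} (hb : 0 ≤ b) (hDb : D ≤ b) (hμ : μ * D ≤ b ^ 2)
    (hA : ∑ i, p ^ (A i).card ≤ μ) (hD : ∀ U : Finset E, U.card ≤ K → ∑ i, meetWeight p A U i ≤ D) :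
    ∀ (m : ℕ) (U : Finset E), U.card + m * k ≤ K →
      ∑ t : Fin m → ι, linkedWeight p A U t ≤ m.factorial * b ^ m := by
  have hD0 : 0 ≤ D := (Finset.sum_nonneg fun i _ => meetWeight_nonneg h0 A ∅ i).trans
    (hD ∅ (by simp))
  have hμ0 : 0 ≤ μ := (Finset.sum_nonneg fun i _ => by positivity).trans hA
  have hcons : ∀ (m : ℕ) (f : (Fin (m + 1) → ι) → ℝ),
      ∑ t, f t = ∑ a, ∑ t : Fin m → ι, f (Fin.cons a t) := fun m f => by
    rw [← (Fin.consEquiv fun _ => ι).sum_comp, Fintype.sum_prod_type]; rfl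
  have hnth : ∀ (m : ℕ) (j : Fin (m + 1)) (f : (Fin (m + 1) → ι) → ℝ),
      ∑ t, f t = ∑ a, ∑ t : Fin m → ι, f (j.insertNth a t) := fun m j f => by
    rw [← (Fin.insertNthEquiv (fun _ => ι) j).sum_comp, Fintype.sum_prod_type]; rfl
  have hcard : ∀ (U : Finset E) (a : ι), (U ∪ A a).card ≤ U.card + k := fun U a =>
    (Finset.card_union_le _ _).trans (Nat.add_le_add_left (hk a) _)
  intro m
  induction m using Nat.strong_induction_on with
  | _ m ih =>
  intro U hU
  match m, ih, hU with
  | 0, _, _ =>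
    simp [linkedWeight, Linked, tupleUnion]
  | 1, ih, hU =>
    rw [hcons]
    have hle : ∀ a, ∑ t : Fin 0 → ι, linkedWeight p A U (Fin.cons a t : Fin 1 → ι) ≤
        meetWeight p A U a := by
      intro a
      have h1 := ih 0 (by omega) (U ∪ A a) (by have := hcard U a; omega)
      refine (Finset.sum_le_sum fun t _ => linkedWeight_cons_le_add h0 A U a t
        (fun j => j.elim0) (fun j => j.elim0) (fun j => j.elim0)).trans ?_
      simp only [Finset.univ_eq_empty, Finset.sum_empty, mul_zero, add_zero, ← Finset.mul_sum]
      have := meetWeight_nonneg h0 A U a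
      simp only [Nat.factorial_zero, Nat.cast_one, pow_zero, mul_one] at h1
      nlinarith
    refine (Finset.sum_le_sum fun a _ => hle a).trans ((hD U (by omega)).trans ?_)
    simpa using hDb
  | m + 2, ih, hU =>
    rw [hcons]
    have hm2 : (m + 2) * k = m * k + k + k := by ring
    have hm1 : (m + 1) * k = m * k + k := by ring
    have hle : ∀ a, ∑ t : Fin (m + 1) → ι, linkedWeight p A U (Fin.cons a t : Fin (m + 2) → ι) ≤
        meetWeight p A U a * ((m + 1).factorial * b ^ (m + 1)) +
          p ^ (A a).card * ((m + 1 : ℕ) * (D * (m.factorial * b ^ m))) := by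
      intro a
      have hUa := hcard U a
      -- The partner `t j` is removed as well: it contributes its `meetWeight` against `U ∪ A a`,
      -- and the remaining m entries are linked relative to the union of all three sets.
      refine (Finset.sum_le_sum fun t _ => linkedWeight_cons_le_add h0 A U a t
        (fun j => meetWeight p A (U ∪ A a) (t j) *
          linkedWeight p A (U ∪ A a ∪ A (t j)) (j.removeNth t))
        (fun j => mul_nonneg (meetWeight_nonneg h0 _ _ _) (linkedWeight_nonneg h0 _ _ _))
        (fun j hj => ?_)).trans ?_
      · rw [meetWeight, if_neg hj]
        conv_lhs => rw [← Fin.insertNth_self_removeNth j t]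
        exact linkedWeight_insertNth_le h0 A _ j _ _
      rw [Finset.sum_add_distrib, ← Finset.mul_sum, ← Finset.mul_sum, Finset.sum_comm]
      refine add_le_add (mul_le_mul_of_nonneg_left (ih (m + 1) (by omega) _ (by omega))
        (meetWeight_nonneg h0 _ _ _)) (mul_le_mul_of_nonneg_left ?_ (by positivity))
      have hj : ∀ j : Fin (m + 1), ∑ t : Fin (m + 1) → ι, meetWeight p A (U ∪ A a) (t j) *
          linkedWeight p A (U ∪ A a ∪ A (t j)) (j.removeNth t) ≤ D * (m.factorial * b ^ m) := by
        intro j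
        rw [hnth m j]
        simp only [Fin.insertNth_apply_same, Fin.removeNth_insertNth, ← Finset.mul_sum]
        calc _ ≤ ∑ c, meetWeight p A (U ∪ A a) c * (m.factorial * b ^ m) :=
              Finset.sum_le_sum fun c _ => mul_le_mul_of_nonneg_left
                (ih m (by omega) _ (by have := hcard (U ∪ A a) c; omega))
                (meetWeight_nonneg h0 _ _ _)
          _ ≤ _ := by
            rw [← Finset.sum_mul]
            exact mul_le_mul_of_nonneg_right (hD _ (by nlinarith)) (by positivity)
      refine (Finset.sum_le_sum fun j _ => hj j).trans (le_of_eq ?_)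
      simp
    refine (Finset.sum_le_sum fun a _ => hle a).trans ?_
    rw [Finset.sum_add_distrib, ← Finset.sum_mul, ← Finset.sum_mul]
    have h1 : (∑ a, meetWeight p A U a) * ((m + 1).factorial * b ^ (m + 1)) ≤
        b * ((m + 1).factorial * b ^ (m + 1)) :=
      mul_le_mul_of_nonneg_right ((hD U (by omega)).trans hDb) (by positivity)
    have h2 : (∑ a, p ^ (A a).card) * ((m + 1 : ℕ) * (D * (m.factorial * b ^ m))) ≤
        b ^ 2 * ((m + 1 : ℕ) * (m.factorial * b ^ m)) := by
      calc _ ≤ μ * ((m + 1 : ℕ) * (D * (m.factorial * b ^ m))) :=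
            mul_le_mul_of_nonneg_right hA (by positivity)
        _ = (μ * D) * ((m + 1 : ℕ) * (m.factorial * b ^ m)) := by ring
        _ ≤ _ := mul_le_mul_of_nonneg_right hμ (by positivity)
    have h3 : (2 : ℝ) * (m + 1).factorial ≤ (m + 2).factorial := by
      rw [Nat.factorial_succ (m + 1)]
      push_cast
      gcongr
      linarith [(Nat.cast_nonneg m : (0 : ℝ) ≤ m)]
    calc _ ≤ b * ((m + 1).factorial * b ^ (m + 1)) +
          b ^ 2 * ((m + 1 : ℕ) * (m.factorial * b ^ m)) := add_le_add h1 h2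
      _ = 2 * (m + 1).factorial * b ^ (m + 2) := by
        rw [Nat.factorial_succ]; push_cast; ring
      _ ≤ _ := by gcongr

variable [Fintype E]

/-- The sum of the centred indicators. -/
noncomputable def centredSum (p : ℝ) (A : ι → Finset E) (S : Finset E) : ℝ :=
  ∑ i, centred p A i S

/-- Expand the power over m-tuples: unlinked tuples vanish and linked ones are bounded by 2^m
p^|union|, so the recursive bound applies with U = ∅. -/
theorem subsetExp_centredSum_pow_le {p : ℝ} (h0 : 0 ≤ p) (h1 : p ≤ 1) (A : ι → Finset E)
    {k : ℕ} (hk : ∀ i, (A i).card ≤ k) {D μ b : ℝ} (hb : 0 ≤ b) (hDb : D ≤ b)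
    (hμ : μ * D ≤ b ^ 2) (hA : ∑ i, p ^ (A i).card ≤ μ) (m : ℕ)
    (hD : ∀ U : Finset E, U.card ≤ m * k → ∑ i, meetWeight p A U i ≤ D) :
    subsetExp p (fun S => centredSum p A S ^ m) ≤ 2 ^ m * (m.factorial * b ^ m) := by
  classical
  simp only [centredSum, Fintype.sum_pow]
  rw [subsetExp_sum]
  refine le_trans (Finset.sum_le_sum (g := fun t => 2 ^ m * linkedWeight p A ∅ t)
    fun t _ => ?_) ?_
  · by_cases ht : Linked A ∅ t
    · rw [linkedWeight, if_pos ht, Finset.sdiff_empty]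
      have := subsetExp_abs_prod_centred_le A h0 h1 Finset.univ t
      rw [Finset.card_univ, Fintype.card_fin] at this
      exact (le_abs_self _).trans ((abs_subsetExp_le h0 h1 _).trans this)
    · rw [subsetExp_prod_centred_eq_zero p A t ht]
      exact mul_nonneg (by positivity) (linkedWeight_nonneg h0 _ _ _)
  · rw [← Finset.mul_sum]
    gcongr
    exact sum_linkedWeight_le h0 A hk hb hDb hμ hA hD m ∅ (by simp)

end Moments

/-! ### Variance and small ball probabilities of sums of centred indicators -/

section Meeting

variable {E ι : Type*} [DecidableEq E] [Fintype ι]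

open Classical in
/-- The indices whose sets meet `U`. -/
noncomputable def meeting (A : ι → Finset E) (U : Finset E) : Finset ι :=
  Finset.univ.filter fun j => ¬ Disjoint (A j) U

/-- The part of the sum coming from sets disjoint from `U`. -/
theorem centredSum_sub_sum_meeting (p : ℝ) (A : ι → Finset E) (U S : Finset E) :
    centredSum p A (S \ U) - ∑ j ∈ meeting A U, centred p A j (S \ U) =
      centredSum p A S - ∑ j ∈ meeting A U, centred p A j S := by
  classical
  have : ∀ S, centredSum p A S - ∑ j ∈ meeting A U, centred p A j S =
      ∑ j ∈ (meeting A U)ᶜ, centred p A j S := fun S => by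
    rw [centredSum, ← Finset.sum_add_sum_compl (meeting A U)]; ring
  rw [this, this]
  refine Finset.sum_congr rfl fun j hj => centred_sdiff p A j ?_ S
  simpa [meeting] using hj

/-- This is the total error in Stein's method. Exposing the three sets in turn, the first costs μ,
while the other two each meet what is already exposed (at most 2k elements) and cost D. -/
theorem sum_meeting_le {p : ℝ} (h0 : 0 ≤ p) (A : ι → Finset E) {k : ℕ}
    (hk : ∀ i, (A i).card ≤ k) {D μ : ℝ} (hA : ∑ i, p ^ (A i).card ≤ μ)
    (hD : ∀ U : Finset E, U.card ≤ 2 * k → ∑ i, meetWeight p A U i ≤ D) :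
    ∑ i, ∑ j ∈ meeting A (A i), ∑ l ∈ meeting A (A i ∪ A j), p ^ (A i ∪ A j ∪ A l).card ≤
      μ * D ^ 2 := by
  have hD0 : 0 ≤ D := (Finset.sum_nonneg fun i _ => meetWeight_nonneg h0 A ∅ i).trans
    (hD ∅ (by simp))
  have hsum : ∀ (U : Finset E) (c : ι → ℝ),
      ∑ j ∈ meeting A U, p ^ (A j \ U).card * c j = ∑ j, meetWeight p A U j * c j := by
    classical
    intro U c
    rw [meeting, Finset.sum_filter]
    refine Finset.sum_congr rfl fun j _ => ?_
    rw [meetWeight]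
    split_ifs <;> simp_all
  have hl : ∀ i j, ∑ l ∈ meeting A (A i ∪ A j), p ^ (A i ∪ A j ∪ A l).card ≤
      p ^ (A i).card * (p ^ (A j \ A i).card * D) := by
    intro i j
    have e : ∀ l, p ^ (A i ∪ A j ∪ A l).card =
        p ^ (A i).card * (p ^ (A j \ A i).card * (p ^ (A l \ (A i ∪ A j)).card * 1)) := by
      intro l
      rw [mul_one, ← pow_add, ← pow_add]
      congr 1
      rw [← Finset.union_sdiff_self_eq_union (s := A i ∪ A j),
        Finset.card_union_of_disjoint Finset.disjoint_sdiff,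
        ← Finset.union_sdiff_self_eq_union (s := A i),
        Finset.card_union_of_disjoint Finset.disjoint_sdiff, add_assoc]
    simp only [e, ← Finset.mul_sum]
    rw [hsum]
    simp only [mul_one]
    gcongr
    refine hD _ ((Finset.card_union_le _ _).trans ?_)
    have := hk i; have := hk j; omega
  calc _ ≤ ∑ i, ∑ j ∈ meeting A (A i), p ^ (A i).card * (p ^ (A j \ A i).card * D) :=
        Finset.sum_le_sum fun i _ => Finset.sum_le_sum fun j _ => hl i j
    _ ≤ ∑ i, p ^ (A i).card * (D * D) := by
        refine Finset.sum_le_sum fun i _ => ?_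
        rw [← Finset.mul_sum, hsum, ← Finset.sum_mul]
        gcongr
        exact hD _ (by have := hk i; omega)
    _ ≤ μ * D ^ 2 := by
        rw [← Finset.sum_mul, ← sq]
        gcongr

end Meeting

/-! ### Covariances, Stein's method and small ball probabilities -/

section SmallBall

variable {E ι : Type*} [DecidableEq E] [Fintype E]

theorem subsetExp_centred_mul (p : ℝ) (A : ι → Finset E) (i j : ι) :
    subsetExp p (fun S => centred p A i S * centred p A j S) =
      p ^ (A i ∪ A j).card - p ^ (A i).card * p ^ (A j).card := by
  have : (fun S => centred p A i S * centred p A j S) = fun S =>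
      (((if A i ∪ A j ⊆ S then (1 : ℝ) else 0) - p ^ (A j).card * (if A i ⊆ S then (1 : ℝ) else 0))
        - p ^ (A i).card * (if A j ⊆ S then (1 : ℝ) else 0)) + p ^ (A i).card * p ^ (A j).card := by
    ext S
    simp only [centred, Finset.union_subset_iff]
    by_cases h1 : A i ⊆ S <;> by_cases h2 : A j ⊆ S <;> simp [h1, h2] <;> ring
  rw [this, subsetExp_add, subsetExp_sub, subsetExp_sub, subsetExp_const_mul, subsetExp_const_mul,
    subsetExp_subset, subsetExp_subset, subsetExp_subset, subsetExp_const]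
  ring

theorem subsetExp_centred_mul_of_disjoint (p : ℝ) (A : ι → Finset E) {i j : ι}
    (h : Disjoint (A i) (A j)) :
    subsetExp p (fun S => centred p A i S * centred p A j S) = 0 := by
  rw [subsetExp_centred_mul, Finset.card_union_of_disjoint h, pow_add, sub_self]

/-- The covariance equals p^|A i ∪ A j| (1 − p^|A i ∩ A j|), and the intersection is nonempty. -/
theorem le_subsetExp_centred_mul {p : ℝ} (h0 : 0 ≤ p) (h1 : p ≤ 1) (A : ι → Finset E) {i j : ι}
    (h : ¬ Disjoint (A i) (A j)) :
    (1 - p) * p ^ (A i ∪ A j).card ≤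
      subsetExp p (fun S => centred p A i S * centred p A j S) := by
  have hc : 1 ≤ (A i ∩ A j).card := by
    rw [Nat.one_le_iff_ne_zero, Finset.card_ne_zero, Finset.nonempty_iff_ne_empty]
    exact fun e => h (Finset.disjoint_iff_inter_eq_empty.2 e)
  rw [subsetExp_centred_mul, ← pow_add, ← Finset.card_union_add_card_inter, pow_add]
  have := pow_le_of_le_one h0 h1 (n := (A i ∩ A j).card) (by omega)
  have h2 : 0 ≤ p ^ (A i ∪ A j).card := by positivity
  nlinarith

theorem subsetExp_abs_centred_mul_mul_le {p : ℝ} (h0 : 0 ≤ p) (h1 : p ≤ 1) (A : ι → Finset E)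
    (i j l : ι) :
    subsetExp p (fun S => |centred p A i S * centred p A j S * centred p A l S|) ≤
      8 * p ^ (A i ∪ A j ∪ A l).card := by
  have h := subsetExp_abs_prod_centred_le A h0 h1 Finset.univ ![i, j, l]
  simp only [Fin.prod_univ_three, Finset.card_univ, Fintype.card_fin] at h
  have e : (Finset.univ.biUnion fun m : Fin 3 => A (![i, j, l] m)) = A i ∪ A j ∪ A l := by
    ext x
    simp [Fin.exists_fin_succ]
  rw [e] at h
  norm_num at h ⊢
  exact h

theorem subsetExp_abs_mul_subsetExp_abs_le {p : ℝ} (h0 : 0 ≤ p) (h1 : p ≤ 1) (A : ι → Finset E)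
    (i j l : ι) :
    subsetExp p (fun S => |centred p A i S * centred p A j S|) *
      subsetExp p (fun S => |centred p A l S|) ≤ 8 * p ^ (A i ∪ A j ∪ A l).card := by
  have h := subsetExp_abs_prod_centred_le A h0 h1 Finset.univ ![i, j]
  simp only [Fin.prod_univ_two, Finset.card_univ, Fintype.card_fin] at h
  have e : (Finset.univ.biUnion fun m : Fin 2 => A (![i, j] m)) = A i ∪ A j := by
    ext x
    simp [Fin.exists_fin_succ]
  rw [e] at h
  have h' := subsetExp_abs_prod_centred_le A h0 h1 Finset.univ ![l]
  simp only [Fin.prod_univ_succ, Finset.card_univ, Fintype.card_fin] at h'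
  have e' : (Finset.univ.biUnion fun m : Fin 1 => A (![l] m)) = A l := by
    ext x
    simp
  rw [e'] at h'
  norm_num at h h'
  simp only [← abs_mul] at h
  calc _ ≤ (4 * p ^ (A i ∪ A j).card) * (2 * p ^ (A l).card) :=
        mul_le_mul h h' (subsetExp_nonneg h0 h1 fun _ => abs_nonneg _) (by positivity)
    _ = 8 * p ^ ((A i ∪ A j).card + (A l).card) := by rw [pow_add]; ring
    _ ≤ _ := by
      exact mul_le_mul_of_nonneg_left
        (pow_le_pow_of_le_one h0 h1 (Finset.card_union_le (A i ∪ A j) (A l))) (by norm_num)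

variable [Fintype ι]

theorem subsetExp_centredSum_sq (p : ℝ) (A : ι → Finset E) :
    subsetExp p (fun S => centredSum p A S ^ 2) =
      ∑ i, ∑ j, subsetExp p (fun S => centred p A i S * centred p A j S) := by
  simp only [centredSum, sq, Finset.sum_mul_sum]
  rw [subsetExp_sum]
  exact Finset.sum_congr rfl fun i _ => subsetExp_sum _ _ _

open Classical in
-- No covariance is negative, so the intersecting pairs cannot be cancelled.
theorem le_subsetExp_centredSum_sq {p : ℝ} (h0 : 0 ≤ p) (h1 : p ≤ 1) (A : ι → Finset E) :
    (1 - p) * ∑ i, ∑ j, (if Disjoint (A i) (A j) then 0 else p ^ (A i ∪ A j).card) ≤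
      subsetExp p (fun S => centredSum p A S ^ 2) := by
  rw [subsetExp_centredSum_sq, Finset.mul_sum]
  refine Finset.sum_le_sum fun i _ => ?_
  rw [Finset.mul_sum]
  refine Finset.sum_le_sum fun j _ => ?_
  split_ifs with h
  · rw [mul_zero, subsetExp_centred_mul_of_disjoint p A h]
  · exact le_subsetExp_centred_mul h0 h1 A h

/-- Deleting from the sum all sets meeting `A i ∪ A j` makes g of the sum independent of the pair.
The Lipschitz bound controls this replacement in each of the two expectations, with error 8 + 8 = 16
per deleted set. -/
theorem abs_subsetExp_stein_pair_le {p : ℝ} (h0 : 0 ≤ p) (h1 : p ≤ 1) (A : ι → Finset E)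
    {g : ℝ → ℝ} {L : ℝ} (hg : ∀ a b, |g a - g b| ≤ L * |a - b|) (i j : ι) :
    |subsetExp p (fun S => centred p A i S * centred p A j S * g (centredSum p A S)) -
      subsetExp p (fun S => centred p A i S * centred p A j S) *
        subsetExp p (fun S => g (centredSum p A S))| ≤
      L * ∑ l ∈ meeting A (A i ∪ A j), 16 * p ^ (A i ∪ A j ∪ A l).card := by
  set N := meeting A (A i ∪ A j) with hN
  have hL : 0 ≤ L := by have := (abs_nonneg _).trans (hg 1 0); simpa using this
  let Y : Finset E → ℝ := fun S => centred p A i S * centred p A j S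
  let G : Finset E → ℝ := fun S => g (centredSum p A S)
  let G' : Finset E → ℝ := fun S => g (centredSum p A S - ∑ l ∈ N, centred p A l S)
  have hGG : ∀ S, |G S - G' S| ≤ L * ∑ l ∈ N, |centred p A l S| := fun S => by
    refine (hg _ _).trans (mul_le_mul_of_nonneg_left ?_ hL)
    rw [sub_sub_cancel]
    exact Finset.abs_sum_le_sum_abs _ _
  have hind : subsetExp p (fun S => Y S * G' S) = subsetExp p Y * subsetExp p G' := by
    refine subsetExp_mul_of_indep p (A i ∪ A j) (fun S => ?_) (fun S => ?_)
    · simp only [Y, centred_inter p A i Finset.subset_union_left,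
        centred_inter p A j Finset.subset_union_right]
    · simp only [G', hN, centredSum_sub_sum_meeting]
  have hsplit : subsetExp p (fun S => Y S * G S) - subsetExp p Y * subsetExp p G =
      subsetExp p (fun S => Y S * (G S - G' S)) -
        subsetExp p Y * subsetExp p (fun S => G S - G' S) := by
    simp only [mul_sub, subsetExp_sub, hind]; ring
  have hb1 : |subsetExp p (fun S => Y S * (G S - G' S))| ≤
      L * ∑ l ∈ N, 8 * p ^ (A i ∪ A j ∪ A l).card := by
    refine (abs_subsetExp_le h0 h1 _).trans ((subsetExp_mono h0 h1
      (g := fun S => L * ∑ l ∈ N, |Y S * centred p A l S|) fun S => ?_).trans ?_)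
    · rw [abs_mul]
      simp only [abs_mul (Y S), ← Finset.mul_sum]
      calc _ ≤ |Y S| * (L * ∑ l ∈ N, |centred p A l S|) :=
            mul_le_mul_of_nonneg_left (hGG S) (abs_nonneg _)
        _ = _ := by ring
    · rw [subsetExp_const_mul, subsetExp_sum]
      exact mul_le_mul_of_nonneg_left (Finset.sum_le_sum fun l _ =>
        subsetExp_abs_centred_mul_mul_le h0 h1 A i j l) hL
  have hb2 : |subsetExp p Y * subsetExp p (fun S => G S - G' S)| ≤
      L * ∑ l ∈ N, 8 * p ^ (A i ∪ A j ∪ A l).card := by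
    rw [abs_mul]
    have h3 : |subsetExp p (fun S => G S - G' S)| ≤
        L * ∑ l ∈ N, subsetExp p (fun S => |centred p A l S|) := by
      refine (abs_subsetExp_le h0 h1 _).trans ((subsetExp_mono h0 h1 hGG).trans ?_)
      rw [subsetExp_const_mul, subsetExp_sum]
    calc _ ≤ subsetExp p (fun S => |Y S|) *
          (L * ∑ l ∈ N, subsetExp p (fun S => |centred p A l S|)) :=
          mul_le_mul (abs_subsetExp_le h0 h1 _) h3 (abs_nonneg _)
            (subsetExp_nonneg h0 h1 fun _ => abs_nonneg _)
      _ = L * ∑ l ∈ N, subsetExp p (fun S => |Y S|) *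
          subsetExp p (fun S => |centred p A l S|) := by
        rw [← Finset.mul_sum]; ring
      _ ≤ _ := mul_le_mul_of_nonneg_left (Finset.sum_le_sum fun l _ =>
          subsetExp_abs_mul_subsetExp_abs_le h0 h1 A i j l) hL
  change |subsetExp p (fun S => Y S * G S) - subsetExp p Y * subsetExp p G| ≤ _
  rw [hsplit]
  refine (abs_sub _ _).trans ((add_le_add hb1 hb2).trans (le_of_eq ?_))
  rw [← mul_add, ← Finset.sum_add_distrib]
  congr 1
  exact Finset.sum_congr rfl fun _ _ => by ring

/-- Here `g` plays the role of f'. Let V be the part of the sum W from sets meeting `A i`. The i-th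
term is centred and independent of W − V, so only f(W) − f(W − V) ≈ V g(W) matters. The Taylor error
contributes 8 and the decoupling of g(W) from each pair contributes 16. -/
theorem abs_subsetExp_stein_single_le {p : ℝ} (h0 : 0 ≤ p) (h1 : p ≤ 1) (A : ι → Finset E)
    {f g : ℝ → ℝ} {L : ℝ} (hf : ∀ a b, |f a - f b - (a - b) * g a| ≤ L * (a - b) ^ 2)
    (hg : ∀ a b, |g a - g b| ≤ L * |a - b|) (i : ι) :
    |subsetExp p (fun S => centred p A i S * f (centredSum p A S)) -
      (∑ j, subsetExp p (fun S => centred p A i S * centred p A j S)) *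
        subsetExp p (fun S => g (centredSum p A S))| ≤
      L * ∑ j ∈ meeting A (A i), ∑ l ∈ meeting A (A i ∪ A j),
        24 * p ^ (A i ∪ A j ∪ A l).card := by
  set N := meeting A (A i) with hN
  have hL : 0 ≤ L := by have := (abs_nonneg _).trans (hg 1 0); simpa using this
  let W : Finset E → ℝ := centredSum p A
  let V : Finset E → ℝ := fun S => ∑ j ∈ N, centred p A j S
  let Y : Finset E → ℝ := centred p A i
  have hz : subsetExp p (fun S => Y S * f (W S - V S)) = 0 := by
    rw [subsetExp_mul_of_indep p (A i), subsetExp_centred, zero_mul]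
    · exact fun S => centred_inter p A i subset_rfl S
    · intro S
      simp only [W, V, hN, centredSum_sub_sum_meeting]
  have hcov : ∑ j, subsetExp p (fun S => Y S * centred p A j S) =
      ∑ j ∈ N, subsetExp p (fun S => Y S * centred p A j S) := by
    refine (Finset.sum_subset (Finset.subset_univ N) fun j _ hj => ?_).symm
    refine subsetExp_centred_mul_of_disjoint p A (Disjoint.symm ?_)
    simpa [hN, meeting] using hj
  have hsplit : subsetExp p (fun S => Y S * f (W S)) =
      subsetExp p (fun S => Y S * (f (W S) - f (W S - V S) - V S * g (W S))) +
        ∑ j ∈ N, subsetExp p (fun S => Y S * centred p A j S * g (W S)) := by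
    have e : (fun S => Y S * f (W S)) = fun S =>
        (Y S * (f (W S) - f (W S - V S) - V S * g (W S)) +
          ∑ j ∈ N, Y S * centred p A j S * g (W S)) + Y S * f (W S - V S) := by
      ext S
      rw [← Finset.sum_mul, ← Finset.mul_sum]
      ring
    rw [e, subsetExp_add, subsetExp_add, hz, add_zero, subsetExp_sum]
  have hb1 : |subsetExp p (fun S => Y S * (f (W S) - f (W S - V S) - V S * g (W S)))| ≤
      L * ∑ j ∈ N, ∑ l ∈ meeting A (A i ∪ A j), 8 * p ^ (A i ∪ A j ∪ A l).card := by
    refine (abs_subsetExp_le h0 h1 _).trans ((subsetExp_mono h0 h1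
      (g := fun S => L * ∑ j ∈ N, ∑ l ∈ N, |Y S * centred p A j S * centred p A l S|)
      fun S => ?_).trans ?_)
    · have h2 : |f (W S) - f (W S - V S) - V S * g (W S)| ≤ L * V S ^ 2 := by
        have := hf (W S) (W S - V S)
        rwa [sub_sub_cancel] at this
      have h3 : V S ^ 2 ≤ ∑ j ∈ N, ∑ l ∈ N, |centred p A j S| * |centred p A l S| := by
        rw [← Finset.sum_mul_sum, ← sq, ← sq_abs]
        exact pow_le_pow_left₀ (abs_nonneg _) (Finset.abs_sum_le_sum_abs _ _) 2
      rw [abs_mul]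
      calc _ ≤ |Y S| * (L * ∑ j ∈ N, ∑ l ∈ N, |centred p A j S| * |centred p A l S|) := by
            gcongr
            exact h2.trans (mul_le_mul_of_nonneg_left h3 hL)
        _ = _ := by
          simp only [abs_mul, mul_assoc]
          simp only [← Finset.mul_sum]
          ring
    · rw [subsetExp_const_mul, subsetExp_sum]
      refine mul_le_mul_of_nonneg_left (Finset.sum_le_sum fun j _ => ?_) hL
      rw [subsetExp_sum]
      calc _ ≤ ∑ l ∈ N, 8 * p ^ (A i ∪ A j ∪ A l).card := Finset.sum_le_sum fun l _ =>
            subsetExp_abs_centred_mul_mul_le h0 h1 A i j l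
        _ ≤ _ := by
          -- Enlarging the range of l to the sets meeting `A i ∪ A j` lets this error be added to
          -- that of `abs_subsetExp_stein_pair_le`.
          refine Finset.sum_le_sum_of_subset_of_nonneg ?_ fun _ _ _ => by positivity
          intro l hl
          simp only [hN, meeting, Finset.mem_filter, Finset.mem_univ, true_and] at hl ⊢
          exact fun hd => hl (Finset.disjoint_union_right.1 hd).1
  change |subsetExp p (fun S => Y S * f (W S)) -
    (∑ j, subsetExp p (fun S => Y S * centred p A j S)) * subsetExp p (fun S => g (W S))| ≤ _
  rw [hsplit, hcov, Finset.sum_mul, add_sub_assoc, ← Finset.sum_sub_distrib]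
  refine (abs_add_le _ _).trans ((add_le_add hb1 ((Finset.abs_sum_le_sum_abs _ _).trans
    (Finset.sum_le_sum fun j _ => abs_subsetExp_stein_pair_le h0 h1 A hg i j))).trans
    (le_of_eq ?_))
  rw [← Finset.mul_sum, ← mul_add, ← Finset.sum_add_distrib]
  congr 1
  refine Finset.sum_congr rfl fun j _ => ?_
  rw [← Finset.sum_add_distrib]
  exact Finset.sum_congr rfl fun _ _ => by ring

theorem abs_subsetExp_stein_le {p : ℝ} (h0 : 0 ≤ p) (h1 : p ≤ 1) (A : ι → Finset E) {k : ℕ}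
    (hk : ∀ i, (A i).card ≤ k) {D μ : ℝ} (hA : ∑ i, p ^ (A i).card ≤ μ)
    (hD : ∀ U : Finset E, U.card ≤ 2 * k → ∑ i, meetWeight p A U i ≤ D)
    {f g : ℝ → ℝ} {L : ℝ} (hf : ∀ a b, |f a - f b - (a - b) * g a| ≤ L * (a - b) ^ 2)
    (hg : ∀ a b, |g a - g b| ≤ L * |a - b|) :
    |subsetExp p (fun S => centredSum p A S * f (centredSum p A S)) -
      subsetExp p (fun S => centredSum p A S ^ 2) *
        subsetExp p (fun S => g (centredSum p A S))| ≤ 24 * L * (μ * D ^ 2) := by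
  have hL : 0 ≤ L := by have := (abs_nonneg _).trans (hg 1 0); simpa using this
  have e : subsetExp p (fun S => centredSum p A S * f (centredSum p A S)) =
      ∑ i, subsetExp p (fun S => centred p A i S * f (centredSum p A S)) := by
    rw [← subsetExp_sum]
    congr 1
    ext S
    rw [← Finset.sum_mul]
    rfl
  rw [e, subsetExp_centredSum_sq, Finset.sum_mul, ← Finset.sum_sub_distrib]
  refine (Finset.abs_sum_le_sum_abs _ _).trans ((Finset.sum_le_sum fun i _ =>
    abs_subsetExp_stein_single_le h0 h1 A hf hg i).trans ?_)
  simp only [← Finset.mul_sum]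
  have := sum_meeting_le h0 A hk hA hD
  calc _ ≤ L * (24 * (μ * D ^ 2)) := by gcongr
    _ = _ := by ring

theorem abs_inv_one_add_sq_sub_le (u v : ℝ) :
    |2 / (1 + u ^ 2) - 2 / (1 + v ^ 2)| ≤ 2 * |u - v| := by
  have e : 2 / (1 + u ^ 2) - 2 / (1 + v ^ 2) =
      2 * (v - u) * ((u + v) / ((1 + u ^ 2) * (1 + v ^ 2))) := by
    have : 1 + u ^ 2 ≠ 0 := by positivity
    have : 1 + v ^ 2 ≠ 0 := by positivity
    field_simp
    ring
  have h : |(u + v) / ((1 + u ^ 2) * (1 + v ^ 2))| ≤ 1 := by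
    rw [abs_div, abs_of_pos (by positivity : 0 < (1 + u ^ 2) * (1 + v ^ 2)),
      div_le_one (by positivity), abs_le]
    constructor <;> nlinarith [sq_nonneg (u - 1 / 2), sq_nonneg (v - 1 / 2), sq_nonneg (u + 1 / 2),
      sq_nonneg (v + 1 / 2), mul_nonneg (sq_nonneg u) (sq_nonneg v)]
  rw [e, abs_mul, abs_mul, abs_two, abs_sub_comm v u]
  exact mul_le_of_le_one_right (by positivity) h

/-- Subtract the linear function with slope the derivative at `a`. On the segment the remaining
derivative is at most (2/s)|a − b|, so the mean value inequality applies. -/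
theorem abs_arctan_taylor_le {s : ℝ} (hs : 0 < s) (a b : ℝ) :
    |2 * s * Real.arctan (a / s) - 2 * s * Real.arctan (b / s) -
      (a - b) * (2 / (1 + (a / s) ^ 2))| ≤ 2 / s * (a - b) ^ 2 := by
  have hder : ∀ x ∈ Set.uIcc a b, HasDerivWithinAt
      (fun x => 2 * s * Real.arctan (x / s) - x * (2 / (1 + (a / s) ^ 2)))
      (2 / (1 + (x / s) ^ 2) - 2 / (1 + (a / s) ^ 2)) (Set.uIcc a b) x := by
    intro x _
    have h1 := (((hasDerivAt_id x).div_const s).arctan.const_mul (2 * s)).sub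
      ((hasDerivAt_id x).mul_const (2 / (1 + (a / s) ^ 2)))
    have e : 2 / (1 + (x / s) ^ 2) - 2 / (1 + (a / s) ^ 2) =
        2 * s * (1 / (1 + (id x / s) ^ 2) * (1 / s)) - 1 * (2 / (1 + (a / s) ^ 2)) := by
      rw [id_eq]; field_simp
    rw [e]
    exact h1.hasDerivWithinAt
  have hb : ∀ x ∈ Set.uIcc a b,
      ‖2 / (1 + (x / s) ^ 2) - 2 / (1 + (a / s) ^ 2)‖ ≤ 2 / s * |a - b| := by
    intro x hx
    have hxa : |x - a| ≤ |a - b| := by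
      rw [abs_sub_comm a b]; exact Set.abs_sub_left_of_mem_uIcc hx
    calc _ ≤ 2 * |x / s - a / s| := abs_inv_one_add_sq_sub_le _ _
      _ = 2 / s * |x - a| := by
        rw [← sub_div, abs_div, abs_of_pos hs]; ring
      _ ≤ _ := by gcongr
  have h := (convex_uIcc a b).norm_image_sub_le_of_norm_hasDerivWithin_le hder hb
    Set.right_mem_uIcc Set.left_mem_uIcc
  rw [Real.norm_eq_abs, Real.norm_eq_abs] at h
  calc _ = |2 * s * Real.arctan (a / s) - a * (2 / (1 + (a / s) ^ 2)) -
        (2 * s * Real.arctan (b / s) - b * (2 / (1 + (a / s) ^ 2)))| := by congr 1; ring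
    _ ≤ _ := h
    _ = _ := by rw [mul_assoc, ← sq, sq_abs]

/-- The sum of the centred indicators does not concentrate on an interval much shorter than its
standard deviation. -/
theorem subsetExp_abs_centredSum_le_le {p : ℝ} (h0 : 0 ≤ p) (h1 : p ≤ 1) (A : ι → Finset E)
    {k : ℕ} (hk : ∀ i, (A i).card ≤ k) {D μ : ℝ} (hA : ∑ i, p ^ (A i).card ≤ μ)
    (hD : ∀ U : Finset E, U.card ≤ 2 * k → ∑ i, meetWeight p A U i ≤ D) {s : ℝ} (hs : 0 < s) :
    subsetExp p (fun S => centredSum p A S ^ 2) *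
      subsetExp p (fun S => if |centredSum p A S| ≤ s then (1 : ℝ) else 0) ≤
      4 * s * √(subsetExp p (fun S => centredSum p A S ^ 2)) + 48 / s * (μ * D ^ 2) := by
  set v := subsetExp p (fun S => centredSum p A S ^ 2) with hv
  have hv0 : 0 ≤ v := subsetExp_nonneg h0 h1 fun _ => sq_nonneg _
  have hst := abs_subsetExp_stein_le h0 h1 A hk hA hD
    (f := fun x => 2 * s * Real.arctan (x / s)) (g := fun x => 2 / (1 + (x / s) ^ 2)) (L := 2 / s)
    (abs_arctan_taylor_le hs) (fun a b => by
      refine (abs_inv_one_add_sq_sub_le _ _).trans (le_of_eq ?_)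
      rw [← sub_div, abs_div, abs_of_pos hs]; ring)
  -- The factor 2 in the test function makes its derivative at least 1 on [−s, s], so the derivative
  -- dominates the indicator.
  have hlow : subsetExp p (fun S => if |centredSum p A S| ≤ s then (1 : ℝ) else 0) ≤
      subsetExp p (fun S => 2 / (1 + (centredSum p A S / s) ^ 2)) := by
    refine subsetExp_mono h0 h1 fun S => ?_
    split_ifs with h
    · rw [le_div_iff₀ (by positivity), one_mul]
      have : (centredSum p A S / s) ^ 2 ≤ 1 := by
        rw [sq_le_one_iff_abs_le_one, abs_div, abs_of_pos hs]
        exact (div_le_one hs).2 h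
      linarith
    · positivity
  -- The test function is bounded by 4s, and E|W| ≤ σ by Cauchy–Schwarz.
  have hup : subsetExp p (fun S => centredSum p A S *
      (2 * s * Real.arctan (centredSum p A S / s))) ≤ 4 * s * √v := by
    have h2 : subsetExp p (fun S => |centredSum p A S|) ≤ √v := by
      refine Real.le_sqrt_of_sq_le ((sq_subsetExp_le h0 h1 _).trans (le_of_eq ?_))
      simp only [sq_abs, hv]
    calc _ ≤ subsetExp p (fun S => 4 * s * |centredSum p A S|) := by
          refine subsetExp_mono h0 h1 fun S => ?_
          have h3 : |Real.arctan (centredSum p A S / s)| ≤ 2 := by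
            have := Real.pi_le_four
            rw [abs_le]
            constructor <;>
              linarith [Real.neg_pi_div_two_lt_arctan (centredSum p A S / s),
                Real.arctan_lt_pi_div_two (centredSum p A S / s)]
          refine (le_abs_self _).trans ?_
          rw [abs_mul, abs_mul, abs_of_pos (by positivity : 0 < 2 * s)]
          calc _ ≤ |centredSum p A S| * (2 * s * 2) := by gcongr
            _ = _ := by ring
      _ = 4 * s * subsetExp p (fun S => |centredSum p A S|) := subsetExp_const_mul _ _ _
      _ ≤ _ := by gcongr
  have h3 := neg_le_of_abs_le hst
  have h4 := mul_le_mul_of_nonneg_left hlow hv0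
  have e : 24 * (2 / s) * (μ * D ^ 2) = 48 / s * (μ * D ^ 2) := by ring
  linarith

end SmallBall

/-! ### The binomial random graph as a binomial random set of pairs -/

section RandomGraph

instance simpleGraph_measurableSingletonClass {n : ℕ} :
    MeasurableSingletonClass (SimpleGraph (Fin n)) := ⟨fun Γ => by
  have h := (Set.toFinite
    ({Γ.edgeSet} : Set (Set (Sym2 (Fin n))))).measurableSet.preimage
    (SimpleGraph.measurable_edgeSet (V := Fin n))
  convert h using 1
  ext Γ'
  simp⟩

theorem binomialRandom_real_singleton {n : ℕ} (p : unitInterval) (Γ : SimpleGraph (Fin n)) :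
    G(Fin n, p).real {Γ} = (p : ℝ) ^ Γ.edgeSet.ncard *
      (1 - p : ℝ) ^ ((Sym2.diagSet : Set (Sym2 (Fin n)))ᶜ \ Γ.edgeSet).ncard := by
  rw [measureReal_def, SimpleGraph.binomialRandom_apply', Set.image_singleton, ← measureReal_def,
    setBernoulli_real_singleton p (by simp) (Set.toFinite _)]

open Classical in
-- Random subsets range over all of `Sym2 (Fin n)`, diagonal included. As `fromEdgeSet` forgets
-- diagonal pairs, each of them is free and contributes the factor p + (1 − p) = 1.
theorem sum_subsetWeight_fromEdgeSet {n : ℕ} (p : ℝ) (Γ : SimpleGraph (Fin n)) :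
    ∑ S ∈ Finset.univ.filter fun S : Finset (Sym2 (Fin n)) =>
        SimpleGraph.fromEdgeSet (S : Set (Sym2 (Fin n))) = Γ,
      subsetWeight p S = p ^ Γ.edgeSet.ncard *
        (1 - p) ^ ((Sym2.diagSet : Set (Sym2 (Fin n)))ᶜ \ Γ.edgeSet).ncard := by
  have hfr : ∀ S : Finset (Sym2 (Fin n)), SimpleGraph.fromEdgeSet (S : Set (Sym2 (Fin n))) = Γ ↔
      ∀ e : Sym2 (Fin n), ¬ e.IsDiag → (e ∈ S ↔ e ∈ Γ.edgeSet) := by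
    intro S
    rw [← SimpleGraph.edgeSet_inj, SimpleGraph.edgeSet_fromEdgeSet, Set.ext_iff]
    refine forall_congr' fun e => ?_
    have : e ∈ Γ.edgeSet → ¬ e.IsDiag := fun h => Γ.not_isDiag_of_mem_edgeSet h
    simp only [Set.mem_sdiff, Finset.mem_coe, Sym2.mem_diagSet]
    tauto
  have h := sum_prod_mem (fun e : Sym2 (Fin n) => if e ∈ Γ.edgeSet ∨ e.IsDiag then p else 0)
    (fun e => if e ∈ Γ.edgeSet then 0 else 1 - p)
  have hl : ∀ S : Finset (Sym2 (Fin n)),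
      (∏ e, if e ∈ S then (if e ∈ Γ.edgeSet ∨ e.IsDiag then p else 0) else
        (if e ∈ Γ.edgeSet then 0 else 1 - p)) =
      if SimpleGraph.fromEdgeSet (S : Set (Sym2 (Fin n))) = Γ then subsetWeight p S else 0 := by
    intro S
    split_ifs with hS
    · rw [hfr] at hS
      refine Finset.prod_congr rfl fun e _ => ?_
      have hd : e ∈ Γ.edgeSet → ¬ e.IsDiag := fun h => Γ.not_isDiag_of_mem_edgeSet h
      have := hS e
      by_cases h1 : e ∈ S <;> by_cases h2 : e ∈ Γ.edgeSet <;> by_cases h3 : e.IsDiag <;>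
        simp_all
    · rw [hfr] at hS
      push Not at hS
      obtain ⟨e, he, h⟩ := hS
      refine Finset.prod_eq_zero (Finset.mem_univ e) ?_
      rcases h with ⟨h1, h2⟩ | ⟨h1, h2⟩ <;> simp [h1, h2, he]
  simp only [hl] at h
  rw [Finset.sum_filter, h]
  have hr : ∀ e : Sym2 (Fin n), ((if e ∈ Γ.edgeSet ∨ e.IsDiag then p else 0) +
      if e ∈ Γ.edgeSet then 0 else 1 - p) = (if e ∈ Γ.edgeSet then p else 1) *
        (if e ∈ (Sym2.diagSet : Set (Sym2 (Fin n)))ᶜ \ Γ.edgeSet then 1 - p else 1) := by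
    intro e
    have hd : e ∈ Γ.edgeSet → ¬ e.IsDiag := fun h => Γ.not_isDiag_of_mem_edgeSet h
    by_cases h2 : e ∈ Γ.edgeSet <;> by_cases h3 : e.IsDiag <;> simp_all
  simp only [hr, Finset.prod_mul_distrib]
  have hp : ∀ (s : Set (Sym2 (Fin n))) [DecidablePred (· ∈ s)] (c : ℝ),
      (∏ e, if e ∈ s then c else 1) = c ^ s.ncard := by
    intro s _ c
    rw [Finset.prod_ite, Finset.prod_const, Finset.prod_const_one, mul_one,
      Set.ncard_eq_toFinset_card']
    congr 2
    ext; simp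
  rw [hp, hp]

theorem integral_binomialRandom {n : ℕ} (p : unitInterval) (F : SimpleGraph (Fin n) → ℝ) :
    ∫ Γ, F Γ ∂G(Fin n, p) = subsetExp (p : ℝ)
      (fun S : Finset (Sym2 (Fin n)) => F (SimpleGraph.fromEdgeSet (S : Set (Sym2 (Fin n))))) := by
  classical
  rw [integral_fintype (.of_finite), subsetExp,
    ← Finset.sum_fiberwise Finset.univ
      (fun S : Finset (Sym2 (Fin n)) => SimpleGraph.fromEdgeSet (S : Set (Sym2 (Fin n))))]
  refine Finset.sum_congr rfl fun Γ _ => ?_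
  rw [binomialRandom_real_singleton, ← sum_subsetWeight_fromEdgeSet, smul_eq_mul, Finset.sum_mul]
  exact Finset.sum_congr rfl fun S hS => by rw [(Finset.mem_filter.1 hS).2]

open Classical in
theorem binomialRandom_real_eq {n : ℕ} (p : unitInterval) (P : SimpleGraph (Fin n) → Prop) :
    G(Fin n, p).real {Γ | P Γ} = subsetExp (p : ℝ) (fun S : Finset (Sym2 (Fin n)) =>
      if P (SimpleGraph.fromEdgeSet (S : Set (Sym2 (Fin n)))) then (1 : ℝ) else 0) := by
  rw [← integral_indicator_one (Set.toFinite _).measurableSet,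
    integral_binomialRandom p (Set.indicator {Γ | P Γ} 1)]
  congr 1

end RandomGraph

namespace RootedGraph

/-! ### Extensions and rooted embeddings -/

variable {V : Type u} {r : ℕ}

theorem extGraph_adj (R : RootedGraph V r) {a b : V} : R.extGraph.Adj a b ↔
    R.graph.Adj a b ∧ ¬ (a ∈ Set.range R.root ∧ b ∈ Set.range R.root) := by
  rw [extGraph, SimpleGraph.deleteEdges_adj, SimpleGraph.Subgraph.mem_edgeSet, rootGraph]
  simp only [SimpleGraph.Subgraph.induce_adj, SimpleGraph.Subgraph.top_adj]
  tauto

/-- The injections of the vertices that map the roots to the tuple `x`. -/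
def RootedEmb (R : RootedGraph V r) {W : Type*} (x : Fin r ↪ W) : Type _ :=
  {φ : V ↪ W // ∀ j, φ (R.root j) = x j}

instance (R : RootedGraph V r) {W : Type*} (x : Fin r ↪ W) [Finite V] [Finite W] :
    Finite (R.RootedEmb x) :=
  inferInstanceAs (Finite {φ : V ↪ W // ∀ j, φ (R.root j) = x j})

noncomputable instance (R : RootedGraph V r) {W : Type*} (x : Fin r ↪ W) [Finite V] [Finite W] :
    Fintype (R.RootedEmb x) :=
  Fintype.ofFinite _

/-- The number of automorphisms of `H_G` that fix the roots. -/
noncomputable def autCard (R : RootedGraph V r) : ℕ :=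
  Nat.card {a : R.extGraph ≃g R.extGraph // ∀ j, a (R.root j) = R.root j}

theorem autCard_pos [Finite V] (R : RootedGraph V r) : 0 < R.autCard := by
  have : Nonempty {a : R.extGraph ≃g R.extGraph // ∀ j, a (R.root j) = R.root j} :=
    ⟨⟨SimpleGraph.Iso.refl, fun _ => rfl⟩⟩
  have : Finite (R.extGraph ≃g R.extGraph) := DFunLike.finite _
  exact Nat.card_pos

/-- The vertex map alone determines the extension, which gives injectivity in `card_rootedEmb_hom`.
-/
theorem eq_map_top_of_iso (R : RootedGraph V r) {W : Type*} {Γ : SimpleGraph W} {F : Γ.Subgraph}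
    (e : R.extGraph ≃g F.coe) {f : R.extGraph →g Γ} (hf : ∀ v, f v = e v) :
    (⊤ : R.extGraph.Subgraph).map f = F := by
  ext a b
  · simp only [SimpleGraph.Subgraph.map_verts, SimpleGraph.Subgraph.verts_top, Set.image_univ,
      Set.mem_range, hf]
    exact ⟨fun ⟨v, hv⟩ => hv ▸ (e v).2, fun h => ⟨e.symm ⟨a, h⟩, by simp⟩⟩
  · simp only [SimpleGraph.Subgraph.map_adj, Relation.Map, SimpleGraph.Subgraph.top_adj, hf]
    constructor
    · rintro ⟨v, w, h, rfl, rfl⟩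
      exact e.map_adj_iff.2 h
    · intro h
      refine ⟨e.symm ⟨a, F.edge_vert h⟩, e.symm ⟨b, F.edge_vert h.symm⟩, ?_, by simp, by simp⟩
      rw [e.symm.map_adj_iff]
      exact h

/-- Each extension arises from `autCard` rooted embeddings. -/
theorem card_rootedEmb_hom (R : RootedGraph V r) {W : Type*} (Γ : SimpleGraph W) (x : Fin r ↪ W) :
    Nat.card {φ : R.RootedEmb x // ∀ a b, R.extGraph.Adj a b → Γ.Adj (φ.1 a) (φ.1 b)} =
      R.extCount Γ x * R.autCard := by
  let I : {F : Γ.Subgraph // R.IsExtension x F} → Type _ := fun F =>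
    {e : R.extGraph ≃g F.1.coe // ∀ j, (e (R.root j) : W) = x j}
  -- Composing with the inverse of one fixed isomorphism identifies all root-respecting isomorphisms
  -- onto a given extension with the root-fixing automorphisms.
  have hI : ∀ F, Nonempty
      (I F ≃ {a : R.extGraph ≃g R.extGraph // ∀ j, a (R.root j) = R.root j}) := by
    rintro ⟨F, e₀, he₀⟩
    refine ⟨⟨fun e => ⟨e.1.trans e₀.symm, fun j => ?_⟩, fun a => ⟨a.1.trans e₀, fun j => ?_⟩,
      fun e => ?_, fun a => ?_⟩⟩
    · change e₀.symm (e.1 (R.root j)) = R.root j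
      rw [show e.1 (R.root j) = e₀ (R.root j) from Subtype.ext ((e.2 j).trans (he₀ j).symm)]
      exact e₀.symm_apply_apply _
    · change (e₀ (a.1 (R.root j)) : W) = x j
      rw [a.2, he₀]
    · refine Subtype.ext (RelIso.ext fun v => ?_)
      exact e₀.apply_symm_apply _
    · refine Subtype.ext (RelIso.ext fun v => ?_)
      exact e₀.symm_apply_apply _
  let toEmb : (Σ F, I F) →
      {φ : R.RootedEmb x // ∀ a b, R.extGraph.Adj a b → Γ.Adj (φ.1 a) (φ.1 b)} := fun q =>
    ⟨⟨⟨fun v => (q.2.1 v : W), fun a b h => q.2.1.injective (Subtype.ext h)⟩, q.2.2⟩,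
      fun a b h => q.1.1.adj_sub (q.2.1.map_adj_iff.2 h)⟩
  have hbij : Function.Bijective toEmb := by
    constructor
    · rintro ⟨⟨F, hF⟩, e, he⟩ ⟨⟨F', hF'⟩, e', he'⟩ h
      have hv : ∀ v, (e v : W) = e' v := fun v =>
        DFunLike.congr_fun (congrArg (fun q => q.1.1) h) v
      have hFF : F = F' := by
        let f : R.extGraph →g Γ := ⟨fun v => e v, fun {a b} h => F.adj_sub (e.map_adj_iff.2 h)⟩
        exact (R.eq_map_top_of_iso e (f := f) fun v => rfl).symm.trans
          (R.eq_map_top_of_iso e' (f := f) hv)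
      subst hFF
      congr 1
      exact Subtype.ext (RelIso.ext fun v => Subtype.ext (hv v))
    · rintro ⟨⟨φ, hφ⟩, h⟩
      let f : SimpleGraph.Copy R.extGraph Γ := ⟨⟨φ, fun {a b} hab => h a b hab⟩, φ.injective⟩
      have hfv : ∀ v, (f.isoToSubgraph v : W) = φ v := fun v => rfl
      refine ⟨⟨⟨f.toSubgraph, f.isoToSubgraph, fun j => ?_⟩, f.isoToSubgraph, fun j => ?_⟩, ?_⟩
      · rw [hfv, hφ]
      · rw [hfv, hφ]
      · rfl
  rw [← Nat.card_eq_of_bijective toEmb hbij,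
    Nat.card_congr (Equiv.sigmaEquivProdOfEquiv fun F => (hI F).some), Nat.card_prod]
  rfl

/-- The edges of `H_G`. -/
noncomputable def extEdges [Finite V] (R : RootedGraph V r) : Finset (Sym2 V) :=
  R.extGraph.edgeSet.toFinite.toFinset

theorem mem_extEdges [Finite V] (R : RootedGraph V r) {e : Sym2 V} :
    e ∈ R.extEdges ↔ e ∈ R.extGraph.edgeSet :=
  Set.Finite.mem_toFinset _

/-- The images of the edges of `H_G` under a rooted embedding. -/
noncomputable def extImage [Finite V] (R : RootedGraph V r) {W : Type*} {x : Fin r ↪ W}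
    (φ : R.RootedEmb x) : Finset (Sym2 W) :=
  R.extEdges.map φ.1.sym2Map

theorem card_extImage [Finite V] (R : RootedGraph V r) {W : Type*} {x : Fin r ↪ W}
    (φ : R.RootedEmb x) : (R.extImage φ).card = R.extEdges.card :=
  Finset.card_map _

theorem extImage_subset_iff [Finite V] (R : RootedGraph V r) {W : Type*} {x : Fin r ↪ W}
    (φ : R.RootedEmb x) (S : Finset (Sym2 W)) : R.extImage φ ⊆ S ↔
      ∀ a b, R.extGraph.Adj a b →
        (SimpleGraph.fromEdgeSet (S : Set (Sym2 W))).Adj (φ.1 a) (φ.1 b) := by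
  rw [extImage, Finset.map_subset_iff_subset_preimage]
  constructor
  · intro h a b hab
    have := h (R.mem_extEdges.2 (SimpleGraph.mem_edgeSet _ |>.2 hab))
    rw [Finset.mem_preimage] at this
    exact (SimpleGraph.fromEdgeSet_adj _).2 ⟨this, φ.1.injective.ne hab.ne⟩
  · intro h e he
    induction e using Sym2.ind with
    | _ a b =>
      rw [Finset.mem_preimage]
      exact ((SimpleGraph.fromEdgeSet_adj _).1 (h a b (R.mem_extEdges.1 he))).1

variable [Finite V]

/-- Counting embeddings instead of unlabelled copies turns the extension count into a sum of
indicators. -/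
theorem autCard_mul_extCount (R : RootedGraph V r) {n : ℕ} (x : Fin r ↪ Fin n)
    (S : Finset (Sym2 (Fin n))) :
    (R.autCard : ℝ) * R.extCount (SimpleGraph.fromEdgeSet (S : Set (Sym2 (Fin n)))) x =
      ∑ φ : R.RootedEmb x, if R.extImage φ ⊆ S then (1 : ℝ) else 0 := by
  classical
  rw [mul_comm, ← Nat.cast_mul, ← card_rootedEmb_hom, Finset.sum_boole, Nat.card_eq_fintype_card,
    Fintype.card_subtype]
  simp only [extImage_subset_iff]

theorem autCard_mul_mean (R : RootedGraph V r) {n : ℕ} (p : unitInterval) (x : Fin r ↪ Fin n) :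
    (R.autCard : ℝ) * R.mean n p =
      Fintype.card (R.RootedEmb x) * (p : ℝ) ^ R.extEdges.card := by
  rw [← R.integral_extCount n p x, integral_binomialRandom, ← subsetExp_const_mul]
  simp only [autCard_mul_extCount]
  rw [subsetExp_sum]
  simp only [subsetExp_subset, card_extImage, Finset.sum_const, Finset.card_univ, nsmul_eq_mul]

theorem centredSum_extImage (R : RootedGraph V r) {n : ℕ} (p : unitInterval) (x : Fin r ↪ Fin n)
    (S : Finset (Sym2 (Fin n))) :
    centredSum (p : ℝ) (R.extImage (x := x)) S = R.autCard *
      (R.extCount (SimpleGraph.fromEdgeSet (S : Set (Sym2 (Fin n)))) x - R.mean n p) := by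
  rw [mul_sub, autCard_mul_extCount, R.autCard_mul_mean p x]
  simp only [centredSum, centred, Finset.sum_sub_distrib, card_extImage, Finset.sum_const,
    Finset.card_univ, nsmul_eq_mul]

end RootedGraph

namespace RootedGraph

/-! ### Counting rooted embeddings -/

section Counting

variable {V : Type u} {r : ℕ} [Finite V] (R : RootedGraph V r) {n : ℕ} (x : Fin r ↪ Fin n)

/-- A root has one possible image, another vertex of `Q` at most |B|, and any vertex outside `Q` at
most n. Using |B| + 1 keeps the base positive, so the exponent can be raised to |V|. -/
theorem card_filter_rootedEmb_le (Q : Set V) (hQ : Set.range R.root ⊆ Q) (B : Finset (Fin n))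
    (P : R.RootedEmb x → Prop) [DecidablePred P]
    (hP : ∀ φ, P φ → ∀ v ∈ Q, v ∉ Set.range R.root → φ.1 v ∈ B) :
    (Finset.univ.filter P).card ≤ (B.card + 1) ^ Nat.card V * n ^ (Nat.card V - Q.ncard) := by
  classical
  cases nonempty_fintype V
  let c : V → Finset (Fin n) := fun v =>
    if v ∈ Set.range R.root then Finset.univ.filter fun w => ∃ j, R.root j = v ∧ x j = w
    else if v ∈ Q then B else Finset.univ
  refine (Finset.card_le_card_of_injOn (s := Finset.univ.filter P)
    (t := Fintype.piFinset c) (fun (φ : R.RootedEmb x) v => φ.1 v)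
    (fun φ hφ => ?_) fun φ _ ψ _ h => Subtype.ext (DFunLike.coe_injective h)).trans ?_
  · have hφ := hP φ (Finset.mem_filter.1 hφ).2
    refine Fintype.mem_piFinset.2 fun v => ?_
    simp only [c]
    split_ifs with h1 h2
    · obtain ⟨j, rfl⟩ := h1
      simpa using (φ.2 j).symm
    · exact hφ v h2 h1
    · exact Finset.mem_univ _
  rw [Fintype.card_piFinset]
  have hc : ∀ v, (c v).card ≤ (if v ∈ Q then B.card + 1 else 1) * if v ∈ Q then 1 else n := by
    intro v
    simp only [c]
    by_cases h2 : v ∈ Q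
    · simp only [h2, if_true, mul_one]
      split_ifs with h1
      · obtain ⟨j, rfl⟩ := h1
        have : (Finset.univ.filter fun w => ∃ i, R.root i = R.root j ∧ x i = w) = {x j} := by
          ext w
          simp [eq_comm]
        rw [this, Finset.card_singleton]
        omega
      · omega
    · rw [if_neg fun h1 => h2 (hQ h1)]
      simp [h2]
  refine (Finset.prod_le_prod' fun v _ => hc v).trans ?_
  rw [Finset.prod_mul_distrib, Finset.prod_ite, Finset.prod_ite]
  simp only [Finset.prod_const, one_pow, mul_one, one_mul]
  have h1 : (Finset.univ.filter fun v => v ∉ Q).card = Nat.card V - Q.ncard := by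
    rw [← Set.ncard_compl, Set.ncard_eq_toFinset_card']
    congr 1
    ext; simp
  rw [h1]
  refine Nat.mul_le_mul_right _ (Nat.pow_le_pow_right (by omega) ?_)
  rw [Nat.card_eq_fintype_card]
  exact Finset.card_le_univ _

theorem card_rootedEmb_le : Fintype.card (R.RootedEmb x) ≤ n ^ (Nat.card V - r) := by
  classical
  have h := R.card_filter_rootedEmb_le x (Set.range R.root) subset_rfl ∅
    (fun _ => True) fun φ _ v hv hv' => absurd hv hv'
  have hr : (Set.range R.root).ncard = r := by
    rw [← Nat.card_coe_set_eq, Nat.card_range_of_injective R.root.injective, Nat.card_fin]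
  rw [hr, Finset.card_empty, zero_add, one_pow, one_mul] at h
  refine le_trans (le_of_eq ?_) h
  rw [Finset.filter_true, Finset.card_univ]

theorem pow_le_card_rootedEmb (hn : 2 * Nat.card V ≤ n) :
    n ^ (Nat.card V - r) ≤ 2 ^ Nat.card V * Fintype.card (R.RootedEmb x) := by
  classical
  cases nonempty_fintype V
  let V' := {v : V // v ∉ Set.range R.root}
  let W' := {w : Fin n // w ∉ Set.range x}
  have hV' : Fintype.card V' = Nat.card V - r := by
    rw [Fintype.card_subtype_compl, Nat.card_eq_fintype_card]
    congr 1
    exact (Fintype.card_congr (Equiv.ofInjective _ R.root.injective).symm).trans (Fintype.card_fin r)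
  have hW' : Fintype.card W' = n - r := by
    rw [Fintype.card_subtype_compl, Fintype.card_fin]
    congr 1
    exact (Fintype.card_congr (Equiv.ofInjective _ x.injective).symm).trans (Fintype.card_fin r)
  have hrV : r ≤ Nat.card V := by
    rw [Nat.card_eq_fintype_card]; simpa using Fintype.card_le_of_embedding R.root
  let F : (V' ↪ W') → R.RootedEmb x := fun g =>
    ⟨⟨fun v => if h : v ∈ Set.range R.root then x h.choose else (g ⟨v, h⟩ : Fin n), by
      intro v w hvw
      by_cases hv : v ∈ Set.range R.root <;> by_cases hw : w ∈ Set.range R.root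
      · simp only [hv, hw, dif_pos] at hvw
        rw [← hv.choose_spec, ← hw.choose_spec, x.injective hvw]
      · simp only [hv, hw, dif_pos] at hvw
        exact absurd ⟨_, hvw⟩ (g ⟨w, hw⟩).2
      · simp only [hv, hw, dif_pos] at hvw
        exact absurd ⟨_, hvw.symm⟩ (g ⟨v, hv⟩).2
      · simp only [hv, hw, dif_neg, not_false_eq_true] at hvw
        exact congrArg Subtype.val (g.injective (Subtype.ext hvw))⟩, fun j => by
      have h : R.root j ∈ Set.range R.root := ⟨j, rfl⟩
      change (if h : R.root j ∈ Set.range R.root then x h.choose else (g ⟨R.root j, h⟩ : Fin n)) = _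
      rw [dif_pos h]
      exact congrArg x (R.root.injective h.choose_spec)⟩
  have hF : Function.Injective F := by
    intro g g' h
    ext v
    have := DFunLike.congr_fun (congrArg Subtype.val h) v.1
    change (if h : v.1 ∈ Set.range R.root then x h.choose else (g ⟨v.1, h⟩ : Fin n)) =
      (if h : v.1 ∈ Set.range R.root then x h.choose else (g' ⟨v.1, h⟩ : Fin n)) at this
    rw [dif_neg v.2, dif_neg v.2] at this
    exact congrArg Fin.val this
  have hcard := Fintype.card_le_of_injective F hF
  rw [Fintype.card_embedding_eq, hV', hW'] at hcard
  have hle : n ^ (Nat.card V - r) ≤ 2 ^ (Nat.card V - r) * (n - r).descFactorial (Nat.card V - r) := by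
    -- Each factor of the falling factorial is at least n − |V| + 1, hence at least n/2.
    refine le_trans ?_ (Nat.mul_le_mul_left _ (Nat.pow_sub_le_descFactorial _ _))
    rw [← mul_pow]
    exact Nat.pow_le_pow_left (by omega) _
  exact hle.trans (Nat.mul_le_mul (Nat.pow_le_pow_right (by norm_num) (Nat.sub_le _ _)) hcard)

end Counting

/-! ### Sub-extensions -/

section Restrict

variable {V : Type u} {r : ℕ} (R : RootedGraph V r)

theorem restrict_extGraph_adj {J : R.graph.Subgraph} (hJ : R.rootGraph ≤ J) {a b : J.verts} :
    (R.restrict J hJ).extGraph.Adj a b ↔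
      J.Adj a b ∧ ¬ ((a : V) ∈ Set.range R.root ∧ (b : V) ∈ Set.range R.root) := by
  rw [extGraph_adj]
  have : ∀ a : J.verts, a ∈ Set.range (R.restrict J hJ).root ↔ (a : V) ∈ Set.range R.root := by
    intro a
    exact ⟨fun ⟨j, h⟩ => ⟨j, congrArg Subtype.val h⟩, fun ⟨j, h⟩ => ⟨j, Subtype.ext h⟩⟩
  rw [this, this]
  rfl

variable [Finite V]

instance : Finite R.graph.Subgraph := by
  refine Finite.of_injective (fun J => (J.verts, J.Adj)) fun J J' h => ?_
  simp only [Prod.mk.injEq] at h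
  exact SimpleGraph.Subgraph.ext h.1 h.2

theorem Phi_le_mean (n : ℕ) (p : unitInterval) {J : R.graph.Subgraph} (hJ : R.rootGraph ≤ J)
    (hJ' : R.rootGraph.edgeSet.ncard < J.edgeSet.ncard) :
    R.Phi n p ≤ (R.restrict J hJ).mean n p :=
  ciInf_le (Set.finite_range _).bddBelow (⟨J, hJ, hJ'⟩ : {J : R.graph.Subgraph //
      R.rootGraph ≤ J ∧ R.rootGraph.edgeSet.ncard < J.edgeSet.ncard})

theorem exists_mean_eq_Phi (hE : R.rootGraph.edgeSet.ncard < R.graph.edgeSet.ncard) (n : ℕ)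
    (p : unitInterval) : ∃ (J : R.graph.Subgraph) (hJ : R.rootGraph ≤ J),
      R.rootGraph.edgeSet.ncard < J.edgeSet.ncard ∧ (R.restrict J hJ).mean n p = R.Phi n p := by
  have : Nonempty {J : R.graph.Subgraph //
      R.rootGraph ≤ J ∧ R.rootGraph.edgeSet.ncard < J.edgeSet.ncard} :=
    ⟨⟨⊤, le_top, by rwa [SimpleGraph.Subgraph.edgeSet_top]⟩⟩
  obtain ⟨J, h⟩ := exists_eq_ciInf_of_finite (f := fun J : {J : R.graph.Subgraph //
      R.rootGraph ≤ J ∧ R.rootGraph.edgeSet.ncard < J.edgeSet.ncard} =>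
    (R.restrict J.1 J.2.1).mean n p)
  exact ⟨J.1, J.2.1, J.2.2, h⟩

/-- The roots together with the endpoints of the edges in `F`. -/
def rootedSupport (F : Set (Sym2 V)) : Set V :=
  Set.range R.root ∪ {v | ∃ e ∈ F, v ∈ e}

/-- The subgraph of `H` with the edges of `G` and the edges in `F`. -/
def adjoinEdges (F : Set (Sym2 V)) (hF : F ⊆ R.graph.edgeSet) : R.graph.Subgraph where
  verts := R.rootedSupport F
  Adj a b := R.rootGraph.Adj a b ∨ s(a, b) ∈ F
  adj_sub h := h.elim (fun h => h.adj_sub) fun h => hF h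
  edge_vert h := h.elim (fun h => Or.inl (R.rootGraph.edge_vert h))
    fun h => Or.inr ⟨_, h, Sym2.mem_mk_left _ _⟩
  symm := ⟨fun _ _ h => h.imp (fun h => h.symm) fun h => Sym2.eq_swap ▸ h⟩

/-- Adjoining `F` and its endpoints to G gives a competitor in the minimum, admissible because `F`
is nonempty and avoids the edges of G. -/
theorem Phi_le_pow_mul_pow {n : ℕ} (p : unitInterval) (x : Fin r ↪ Fin n) {F : Finset (Sym2 V)}
    (hF : F ⊆ R.extEdges) (hne : F.Nonempty) :
    R.Phi n p ≤ (n : ℝ) ^ ((R.rootedSupport (F : Set (Sym2 V))).ncard - r) * (p : ℝ) ^ F.card := by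
  classical
  have hFe : ∀ e ∈ F, e ∈ R.extGraph.edgeSet := fun e he => R.mem_extEdges.1 (hF he)
  have hFg : (F : Set (Sym2 V)) ⊆ R.graph.edgeSet := fun e he =>
    SimpleGraph.edgeSet_mono (SimpleGraph.deleteEdges_le _) (hFe e he)
  set J := R.adjoinEdges (F : Set (Sym2 V)) hFg with hJdef
  have hJ : R.rootGraph ≤ J := ⟨fun v hv => Or.inl hv, fun a b h => Or.inl h⟩
  have hlt : R.rootGraph.edgeSet.ncard < J.edgeSet.ncard := by
    refine Set.ncard_lt_ncard ⟨SimpleGraph.Subgraph.edgeSet_mono hJ, fun h => ?_⟩ (Set.toFinite _)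
    obtain ⟨e, he⟩ := hne
    have h1 : e ∈ J.edgeSet := by
      induction e using Sym2.ind with
      | _ a b => exact Or.inr he
    have h2 := hFe e he
    rw [extGraph, SimpleGraph.edgeSet_deleteEdges] at h2
    exact h2.2 (h h1)
  refine (R.Phi_le_mean n p hJ hlt).trans ?_
  set R' := R.restrict J hJ
  have hp0 : (0 : ℝ) ≤ p := p.2.1
  have hp1 : (p : ℝ) ≤ 1 := p.2.2
  have hcard : F.card ≤ R'.extEdges.card := by
    rw [← Finset.card_map (f := (Function.Embedding.subtype fun v => v ∈ J.verts).sym2Map)]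
    refine Finset.card_le_card fun e he => ?_
    induction e using Sym2.ind with
    | _ a b =>
      have hadj : R.extGraph.Adj a b := hFe _ he
      have ha : a ∈ J.verts := Or.inr ⟨_, he, Sym2.mem_mk_left _ _⟩
      have hb : b ∈ J.verts := Or.inr ⟨_, he, Sym2.mem_mk_right _ _⟩
      refine Finset.mem_map.2 ⟨s(⟨a, ha⟩, ⟨b, hb⟩), R'.mem_extEdges.2 ?_, rfl⟩
      exact (R.restrict_extGraph_adj hJ).2 ⟨Or.inr he, (R.extGraph_adj.1 hadj).2⟩
  have hmean := R'.autCard_mul_mean p x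
  have ha : (1 : ℝ) ≤ R'.autCard := by exact_mod_cast R'.autCard_pos
  have hm0 : 0 ≤ R'.mean n p := by
    rw [← R'.integral_extCount n p x]
    exact integral_nonneg fun _ => Nat.cast_nonneg _
  calc R'.mean n p ≤ R'.autCard * R'.mean n p := le_mul_of_one_le_left hm0 ha
    _ = Fintype.card (R'.RootedEmb x) * (p : ℝ) ^ R'.extEdges.card := hmean
    _ ≤ _ := by
      gcongr ?_ * ?_
      · have := R'.card_rootedEmb_le x
        rw [Nat.card_coe_set_eq] at this
        exact_mod_cast this
      · exact pow_le_pow_of_le_one hp0 hp1 hcard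

end Restrict

end RootedGraph

namespace RootedGraph

/-! ### Overlaps and variance of extension counts -/

section Overlap

variable {V : Type u} {r : ℕ} [Finite V] (R : RootedGraph V r) {n : ℕ}

/-- The exact set of edges sent into `U` is one of the summands `F`. Summing over all nonempty `F`
removes the dependence of this set on φ. -/
theorem meetWeight_extImage_le {p : ℝ} (h0 : 0 ≤ p) (x : Fin r ↪ Fin n)
    (U : Finset (Sym2 (Fin n))) (φ : R.RootedEmb x) :
    meetWeight p (R.extImage (x := x)) U φ ≤
      ∑ F ∈ R.extEdges.powerset.filter Finset.Nonempty,
        if ∀ e ∈ F, φ.1.sym2Map e ∈ U then p ^ (R.extEdges.card - F.card) else 0 := by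
  classical
  have hnn : ∀ F ∈ R.extEdges.powerset.filter Finset.Nonempty, (0 : ℝ) ≤
      if ∀ e ∈ F, φ.1.sym2Map e ∈ U then p ^ (R.extEdges.card - F.card) else 0 := by
    intro F _
    split_ifs <;> positivity
  rw [meetWeight]
  split_ifs with hd
  · exact Finset.sum_nonneg hnn
  set F₀ := R.extEdges.filter fun e => φ.1.sym2Map e ∈ U with hF₀
  have hmem : F₀ ∈ R.extEdges.powerset.filter Finset.Nonempty := by
    refine Finset.mem_filter.2 ⟨Finset.mem_powerset.2 (Finset.filter_subset _ _), ?_⟩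
    obtain ⟨e', he', heU⟩ := Finset.not_disjoint_iff.1 hd
    obtain ⟨e, he, rfl⟩ := Finset.mem_map.1 he'
    exact ⟨e, Finset.mem_filter.2 ⟨he, heU⟩⟩
  refine le_trans (le_of_eq ?_) (Finset.single_le_sum hnn hmem)
  rw [if_pos fun e he => (Finset.mem_filter.1 he).2]
  congr 1
  have : R.extImage φ \ U = (R.extEdges \ F₀).map φ.1.sym2Map := by
    ext e'
    simp only [extImage, Finset.mem_sdiff, Finset.mem_map, hF₀, Finset.mem_filter]
    constructor
    · rintro ⟨⟨e, he, rfl⟩, h⟩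
      exact ⟨e, ⟨he, fun h' => h h'.2⟩, rfl⟩
    · rintro ⟨e, ⟨he, h⟩, rfl⟩
      exact ⟨⟨e, he, rfl⟩, fun h' => h ⟨he, h'⟩⟩
  rw [this, Finset.card_map, Finset.card_sdiff_of_subset (Finset.filter_subset _ _)]

/-- A bound for the ratio between `μ / Φ` and the expected number of extensions that overlap
a given set of at most `K` edges. -/
noncomputable def overlapConst (K : ℕ) : ℝ :=
  2 ^ R.extEdges.card * ((2 * K + 1 : ℕ) ^ Nat.card V * 2 ^ Nat.card V)

theorem one_le_overlapConst (K : ℕ) : 1 ≤ R.overlapConst K := by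
  have h2 : ∀ m, (1 : ℝ) ≤ 2 ^ m := fun m => one_le_pow₀ one_le_two
  have h3 : (1 : ℝ) ≤ (2 * K + 1 : ℕ) ^ Nat.card V := by
    exact_mod_cast Nat.one_le_pow _ _ (by omega)
  exact one_le_mul_of_one_le_of_one_le (h2 _) (one_le_mul_of_one_le_of_one_le h3 (h2 _))

/-- For each nonempty `F`, the vertices it touches must land among the at most 2K endpoints of `U`.
The lost factor n^(new vertices) p^|F| is at least Φ by `Phi_le_pow_mul_pow`. -/
theorem sum_meetWeight_extImage_le (p : unitInterval) (x : Fin r ↪ Fin n)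
    (hn : 2 * Nat.card V ≤ n) (hΦ : 0 < R.Phi n p) {K : ℕ} {U : Finset (Sym2 (Fin n))}
    (hU : U.card ≤ K) :
    ∑ φ, meetWeight (p : ℝ) (R.extImage (x := x)) U φ ≤ R.overlapConst K *
      (Fintype.card (R.RootedEmb x) * (p : ℝ) ^ R.extEdges.card / R.Phi n p) := by
  classical
  have hp0 : (0 : ℝ) ≤ p := p.2.1
  refine (Finset.sum_le_sum fun φ _ => R.meetWeight_extImage_le hp0 x U φ).trans ?_
  rw [Finset.sum_comm]
  set B := U.biUnion Sym2.toFinset with hB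
  have hBcard : B.card ≤ 2 * K := by
    refine Finset.card_biUnion_le.trans ?_
    refine (Finset.sum_le_card_nsmul _ _ 2 fun e _ => ?_).trans ?_
    · rw [Sym2.card_toFinset]; split_ifs <;> omega
    · rw [smul_eq_mul]; omega
  have hterm : ∀ F ∈ R.extEdges.powerset.filter Finset.Nonempty,
      ∑ φ : R.RootedEmb x, (if ∀ e ∈ F, φ.1.sym2Map e ∈ U then
        (p : ℝ) ^ (R.extEdges.card - F.card) else 0) ≤
      ((2 * K + 1 : ℕ) ^ Nat.card V * 2 ^ Nat.card V) *
        (Fintype.card (R.RootedEmb x) * (p : ℝ) ^ R.extEdges.card / R.Phi n p) := by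
    intro F hF
    obtain ⟨hFE, hne⟩ := Finset.mem_filter.1 hF
    rw [Finset.mem_powerset] at hFE
    set Q := R.rootedSupport (F : Set (Sym2 V)) with hQ
    have hrQ : r ≤ Q.ncard := by
      have hr : (Set.range R.root).ncard = r := by
        rw [← Nat.card_coe_set_eq, Nat.card_range_of_injective R.root.injective, Nat.card_fin]
      conv_lhs => rw [← hr]
      exact Set.ncard_le_ncard Set.subset_union_left (Set.toFinite _)
    have hQV : Q.ncard ≤ Nat.card V := by
      rw [← Set.ncard_univ]
      exact Set.ncard_le_ncard (Set.subset_univ _) (Set.toFinite _)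
    have hcount := R.card_filter_rootedEmb_le x Q Set.subset_union_left B
      (fun φ => ∀ e ∈ F, φ.1.sym2Map e ∈ U) (by
        intro φ hφ v hv hvr
        obtain ⟨e, he, hve⟩ := hv.resolve_left hvr
        refine Finset.mem_biUnion.2 ⟨_, hφ e he, Sym2.mem_toFinset.2 ?_⟩
        exact Sym2.mem_map.2 ⟨v, hve, rfl⟩)
    have hcount' : ((Finset.univ.filter fun φ : R.RootedEmb x =>
        ∀ e ∈ F, φ.1.sym2Map e ∈ U).card : ℝ) ≤
        (2 * K + 1 : ℕ) ^ Nat.card V * (n : ℝ) ^ (Nat.card V - Q.ncard) := by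
      refine (Nat.cast_le.2 hcount).trans ?_
      push_cast
      gcongr
      exact_mod_cast hBcard
    have hN : (n : ℝ) ^ (Nat.card V - r) ≤ 2 ^ Nat.card V * Fintype.card (R.RootedEmb x) := by
      exact_mod_cast R.pow_le_card_rootedEmb x hn
    have hΦF := R.Phi_le_pow_mul_pow p x hFE hne
    rw [← Finset.sum_filter, Finset.sum_const, nsmul_eq_mul, mul_div_assoc', le_div_iff₀ hΦ]
    calc _ ≤ (2 * K + 1 : ℕ) ^ Nat.card V * (n : ℝ) ^ (Nat.card V - Q.ncard) *
          (p : ℝ) ^ (R.extEdges.card - F.card) * ((n : ℝ) ^ (Q.ncard - r) * (p : ℝ) ^ F.card) := by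
          gcongr
      _ = (2 * K + 1 : ℕ) ^ Nat.card V *
          ((n : ℝ) ^ (Nat.card V - Q.ncard) * (n : ℝ) ^ (Q.ncard - r)) *
          ((p : ℝ) ^ (R.extEdges.card - F.card) * (p : ℝ) ^ F.card) := by ring
      _ = (2 * K + 1 : ℕ) ^ Nat.card V * (n : ℝ) ^ (Nat.card V - r) *
          (p : ℝ) ^ R.extEdges.card := by
          rw [← pow_add, ← pow_add, Nat.sub_add_cancel (Finset.card_le_card hFE),
            show Nat.card V - Q.ncard + (Q.ncard - r) = Nat.card V - r by omega]
      _ ≤ (2 * K + 1 : ℕ) ^ Nat.card V * (2 ^ Nat.card V * Fintype.card (R.RootedEmb x)) *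
          (p : ℝ) ^ R.extEdges.card := by gcongr
      _ = _ := by ring
  refine (Finset.sum_le_card_nsmul _ _ _ hterm).trans ?_
  rw [nsmul_eq_mul, overlapConst, mul_assoc ((2 : ℝ) ^ R.extEdges.card)]
  have hcard : ((R.extEdges.powerset.filter Finset.Nonempty).card : ℝ) ≤
      2 ^ R.extEdges.card := by
    have := (Finset.card_filter_le R.extEdges.powerset Finset.Nonempty).trans_eq
      (Finset.card_powerset _)
    exact_mod_cast this
  exact mul_le_mul_of_nonneg_right hcard (by positivity)

variable {R} in
/-- The restriction of a rooted embedding to the vertices of a subgraph. -/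
def RootedEmb.restrict {x : Fin r ↪ Fin n} (φ : R.RootedEmb x) {J : R.graph.Subgraph}
    (hJ : R.rootGraph ≤ J) : (R.restrict J hJ).RootedEmb x :=
  ⟨(Function.Embedding.subtype fun v => v ∈ J.verts).trans φ.1, fun j => φ.2 j⟩

theorem extImage_restrict_subset {x : Fin r ↪ Fin n} (φ : R.RootedEmb x) {J : R.graph.Subgraph}
    (hJ : R.rootGraph ≤ J) :
    (R.restrict J hJ).extImage (φ.restrict hJ) ⊆ R.extImage φ := by
  intro e' he'
  obtain ⟨e, he, rfl⟩ := Finset.mem_map.1 he'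
  induction e using Sym2.ind with
  | _ a b =>
    refine Finset.mem_map.2 ⟨s((a : V), (b : V)), R.mem_extEdges.2 ?_, rfl⟩
    have h := (R.restrict_extGraph_adj hJ).1 ((R.restrict J hJ).mem_extEdges.1 he)
    exact R.extGraph_adj.2 ⟨h.1.adj_sub, h.2⟩

theorem extEdges_restrict_nonempty {J : R.graph.Subgraph} (hJ : R.rootGraph ≤ J)
    (hJ' : R.rootGraph.edgeSet.ncard < J.edgeSet.ncard) :
    (R.restrict J hJ).extEdges.Nonempty := by
  by_contra hemp
  rw [Finset.not_nonempty_iff_eq_empty] at hemp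
  refine hJ'.not_ge (Set.ncard_le_ncard (fun e he => ?_) (Set.toFinite _))
  induction e using Sym2.ind with
  | _ a b =>
    have hab : J.Adj a b := he
    have h := Finset.notMem_empty (s((⟨a, J.edge_vert hab⟩ : J.verts), ⟨b, J.edge_vert hab.symm⟩))
    rw [← hemp, mem_extEdges, SimpleGraph.mem_edgeSet, restrict_extGraph_adj, not_and_not_right] at h
    have hr := h hab
    rw [SimpleGraph.Subgraph.mem_edgeSet, rootGraph, SimpleGraph.Subgraph.induce_adj]
    exact ⟨hr.1, hr.2, hab.adj_sub⟩

/-- Only pairs of embeddings with the same restriction to `J` are used. They share all e' extension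
edges of `J`, so their union has at most 2e − e' edges. Cauchy–Schwarz over the N' restrictions
shows that there are at least N²/N' such pairs. -/
theorem le_variance_mul_mean (p : unitInterval) (x : Fin r ↪ Fin n) {J : R.graph.Subgraph}
    (hJ : R.rootGraph ≤ J) (hJ' : R.rootGraph.edgeSet.ncard < J.edgeSet.ncard) :
    (1 - (p : ℝ)) * (Fintype.card (R.RootedEmb x) * (p : ℝ) ^ R.extEdges.card) ^ 2 ≤
      subsetExp (p : ℝ) (fun S => centredSum (p : ℝ) (R.extImage (x := x)) S ^ 2) *
        ((R.restrict J hJ).autCard * (R.restrict J hJ).mean n p) := by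
  classical
  have hp0 : (0 : ℝ) ≤ p := p.2.1
  have hp1 : (p : ℝ) ≤ 1 := p.2.2
  set R' := R.restrict J hJ with hR'
  rw [R'.autCard_mul_mean p x]
  set N := Fintype.card (R.RootedEmb x)
  set N' := Fintype.card (R'.RootedEmb x)
  set e := R.extEdges.card
  set e' := R'.extEdges.card
  let T : ℝ := ∑ φ : R.RootedEmb x, ∑ ψ : R.RootedEmb x,
    if φ.restrict hJ = ψ.restrict hJ then (1 : ℝ) else 0
  have hT : (N : ℝ) ^ 2 ≤ N' * T := by
    let c : R'.RootedEmb x → ℝ := fun χ => ∑ φ : R.RootedEmb x, if φ.restrict hJ = χ then 1 else 0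
    have h1 : ∑ χ, c χ = N := by
      simp only [c]
      rw [Finset.sum_comm]
      simp [N]
    have h2 : ∑ χ, c χ ^ 2 = T := by
      simp only [c, sq, Finset.sum_mul_sum, T]
      rw [Finset.sum_comm]
      refine Finset.sum_congr rfl fun φ _ => ?_
      rw [Finset.sum_comm]
      refine Finset.sum_congr rfl fun ψ _ => ?_
      simp [eq_comm]
    rw [← h1, ← h2]
    exact sq_sum_le_card_mul_sum_sq
  have hpair : T * (p : ℝ) ^ (2 * e) ≤ (∑ φ : R.RootedEmb x, ∑ ψ : R.RootedEmb x,
      if Disjoint (R.extImage φ) (R.extImage ψ) then 0 else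
        (p : ℝ) ^ (R.extImage φ ∪ R.extImage ψ).card) * (p : ℝ) ^ e' := by
    simp only [T, Finset.sum_mul]
    refine Finset.sum_le_sum fun φ _ => Finset.sum_le_sum fun ψ _ => ?_
    by_cases hφψ : φ.restrict hJ = ψ.restrict hJ
    swap
    · rw [if_neg hφψ, zero_mul]
      split_ifs <;> positivity
    have hsub : R'.extImage (φ.restrict hJ) ⊆ R.extImage φ ∩ R.extImage ψ :=
      Finset.subset_inter (R.extImage_restrict_subset φ hJ)
        (hφψ ▸ R.extImage_restrict_subset ψ hJ)
    have hcard := Finset.card_le_card hsub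
    rw [card_extImage] at hcard
    have hpos : 0 < R'.extEdges.card := Finset.card_pos.2 (R.extEdges_restrict_nonempty hJ hJ')
    have hnd : ¬ Disjoint (R.extImage φ) (R.extImage ψ) := by
      rw [Finset.disjoint_iff_inter_eq_empty]
      intro h0
      rw [h0, Finset.card_empty] at hcard
      omega
    rw [if_pos hφψ, if_neg hnd, one_mul, ← pow_add]
    refine pow_le_pow_of_le_one hp0 hp1 ?_
    have := Finset.card_union_add_card_inter (R.extImage φ) (R.extImage ψ)
    rw [card_extImage, card_extImage] at this
    simp only [e, e']
    omega
  have hvar := le_subsetExp_centredSum_sq hp0 hp1 (R.extImage (x := x))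
  have h1p : 0 ≤ 1 - (p : ℝ) := by linarith
  calc _ = (1 - (p : ℝ)) * ((N : ℝ) ^ 2 * (p : ℝ) ^ (2 * e)) := by rw [mul_pow, ← pow_mul, mul_comm e]
    _ ≤ (1 - (p : ℝ)) * (N' * T * (p : ℝ) ^ (2 * e)) := by gcongr
    _ = (1 - (p : ℝ)) * (N' * (T * (p : ℝ) ^ (2 * e))) := by ring
    _ ≤ (1 - (p : ℝ)) * (N' * ((∑ φ : R.RootedEmb x, ∑ ψ : R.RootedEmb x,
        if Disjoint (R.extImage φ) (R.extImage ψ) then 0 else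
          (p : ℝ) ^ (R.extImage φ ∪ R.extImage ψ).card) * (p : ℝ) ^ e')) := by gcongr
    _ = ((1 - (p : ℝ)) * ∑ φ : R.RootedEmb x, ∑ ψ : R.RootedEmb x,
        if Disjoint (R.extImage φ) (R.extImage ψ) then 0 else
          (p : ℝ) ^ (R.extImage φ ∪ R.extImage ψ).card) * (N' * (p : ℝ) ^ e') := by ring
    _ ≤ _ := mul_le_mul_of_nonneg_right hvar (by positivity)

/-- The variance of the extension count is at least of order `(1 - p) μ ^ 2 / Φ`. -/
theorem exists_le_variance_mul_Phi (hE : R.rootGraph.edgeSet.ncard < R.graph.edgeSet.ncard) :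
    ∃ C : ℝ, 0 < C ∧ ∀ (n : ℕ) (p : unitInterval) (x : Fin r ↪ Fin n),
      (1 - (p : ℝ)) * (R.autCard * R.mean n p) ^ 2 ≤
        subsetExp (p : ℝ) (fun S => centredSum (p : ℝ) (R.extImage (x := x)) S ^ 2) *
          (C * R.Phi n p) := by
  -- The minimising J varies with n and p; since there are finitely many candidates, one constant
  -- bounds all their automorphism counts.
  obtain ⟨M, hM⟩ := (Set.finite_range fun J : {J : R.graph.Subgraph // R.rootGraph ≤ J} =>
    (R.restrict J.1 J.2).autCard).bddAbove
  refine ⟨M + 1, by positivity, fun n p x => ?_⟩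
  obtain ⟨J, hJ, hJ', hmean⟩ := R.exists_mean_eq_Phi hE n p
  have hM' : (R.restrict J hJ).autCard ≤ M := hM ⟨⟨J, hJ⟩, rfl⟩
  have hm0 : 0 ≤ (R.restrict J hJ).mean n p := by
    rw [← (R.restrict J hJ).integral_extCount n p x]
    exact integral_nonneg fun _ => Nat.cast_nonneg _
  rw [R.autCard_mul_mean p x]
  refine (R.le_variance_mul_mean p x hJ hJ').trans ?_
  rw [← hmean]
  refine mul_le_mul_of_nonneg_left (mul_le_mul_of_nonneg_right ?_ hm0)
    (subsetExp_nonneg p.2.1 p.2.2 fun _ => sq_nonneg _)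
  have : ((R.restrict J hJ).autCard : ℝ) ≤ M := by exact_mod_cast hM'
  linarith

end Overlap

end RootedGraph

namespace RootedGraph

/-! ### Concentration and anticoncentration of a single extension count -/

section SingleRoot

variable {V : Type u} {r : ℕ} [Finite V] (R : RootedGraph V r) {n : ℕ}

/-- Since H_G has an edge, p = 0 would force Φ ≤ 0. -/
theorem mean_pos_of_Phi_pos (hE : R.rootGraph.edgeSet.ncard < R.graph.edgeSet.ncard)
    (p : unitInterval) (x : Fin r ↪ Fin n) (hn : 2 * Nat.card V ≤ n) (hΦ : 0 < R.Phi n p) :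
    0 < R.autCard * R.mean n p := by
  have hne : R.extEdges.Nonempty := by
    by_contra h
    rw [Finset.not_nonempty_iff_eq_empty] at h
    refine hE.not_ge (Set.ncard_le_ncard (fun e he => ?_) (Set.toFinite _))
    by_contra he'
    have : e ∈ R.extEdges := by
      rw [mem_extEdges, extGraph, SimpleGraph.edgeSet_deleteEdges]
      exact ⟨he, he'⟩
    simp [h] at this
  have hp0 : (0 : ℝ) ≤ p := p.2.1
  have hp : 0 < (p : ℝ) := by
    refine lt_of_le_of_ne hp0 fun h => ?_
    have h1 := R.Phi_le_pow_mul_pow p x subset_rfl hne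
    rw [← h, zero_pow (Finset.card_pos.2 hne).ne', mul_zero] at h1
    linarith
  have hn0 : 0 < n := by
    obtain ⟨e, he⟩ := hne
    have : Nonempty V := ⟨e.out.1⟩
    have : 0 < Nat.card V := Nat.card_pos
    omega
  have hN : 0 < Fintype.card (R.RootedEmb x) := by
    have h1 := R.pow_le_card_rootedEmb x hn
    have h2 : 0 < n ^ (Nat.card V - r) := Nat.pow_pos hn0
    exact Nat.pos_of_mul_pos_left (h2.trans_le h1)
  rw [R.autCard_mul_mean p x]
  positivity

theorem abs_sub_mean_lt_iff (p : unitInterval) (x : Fin r ↪ Fin n) (S : Finset (Sym2 (Fin n)))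
    (t : ℝ) :
    |(R.extCount (SimpleGraph.fromEdgeSet (S : Set (Sym2 (Fin n)))) x : ℝ) - R.mean n p| <
        t * R.mean n p ↔
      |centredSum (p : ℝ) (R.extImage (x := x)) S| < t * (R.autCard * R.mean n p) := by
  have ha : (0 : ℝ) < R.autCard := by exact_mod_cast R.autCard_pos
  rw [centredSum_extImage, abs_mul, abs_of_pos ha, mul_left_comm, mul_lt_mul_iff_right₀ ha]

/-- The probability that an extension count is unusually close to its mean. -/
theorem binomialRandom_abs_sub_mean_lt_le
    (hE : R.rootGraph.edgeSet.ncard < R.graph.edgeSet.ncard) {c : ℝ} (hc : 0 < c) :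
    ∃ κ C : ℝ, 0 < κ ∧ 0 < C ∧ ∀ (n : ℕ) (p : unitInterval) (x : Fin r ↪ Fin n) (t δ : ℝ),
      2 * Nat.card V ≤ n → c ≤ 1 - (p : ℝ) → 0 < R.Phi n p → 0 < δ →
      t * √(R.Phi n p) ≤ δ * κ →
      G(Fin n, p).real {Γ : SimpleGraph (Fin n) |
        |(R.extCount Γ x : ℝ) - R.mean n p| < t * R.mean n p} ≤
        4 * δ + C / (δ * √(R.Phi n p)) := by
  classical
  obtain ⟨M, hM, hvar⟩ := R.exists_le_variance_mul_Phi hE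
  set e := R.extEdges.card
  set C₀ := R.overlapConst (2 * e)
  have hC₀ : 0 < C₀ := zero_lt_one.trans_le (R.one_le_overlapConst _)
  have hκ : 0 < √(c / M) := Real.sqrt_pos.2 (div_pos hc hM)
  -- With m the scaled mean, κ = √(c/M) is the constant in σ ≥ κm/√Φ. The second constant results
  -- from 48 m D²/(δσ³) with D = C₀m/Φ.
  refine ⟨√(c / M), 48 * C₀ ^ 2 / √(c / M) ^ 3, hκ, by positivity, ?_⟩
  intro n p x t δ hn hp hΦ hδ ht
  have hp0 : (0 : ℝ) ≤ p := p.2.1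
  have hp1 : (p : ℝ) ≤ 1 := p.2.2
  have hv := hvar n p x
  have hμ := R.mean_pos_of_Phi_pos hE p x hn hΦ
  set κ := √(c / M)
  set μ := R.autCard * R.mean n p with hμdef
  set v := subsetExp (p : ℝ) (fun S => centredSum (p : ℝ) (R.extImage (x := x)) S ^ 2) with hvdef
  set y := √(R.Phi n p)
  have hy : 0 < y := Real.sqrt_pos.2 hΦ
  have hyy : R.Phi n p = y ^ 2 := (Real.sq_sqrt hΦ.le).symm
  have hκκ : κ ^ 2 * M = c := by
    rw [Real.sq_sqrt (div_pos hc hM).le]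
    field_simp
  have hσ : κ * μ / y ≤ √v := by
    refine Real.le_sqrt_of_sq_le ?_
    rw [div_pow, div_le_iff₀ (by positivity), ← hyy]
    have h1 : c * μ ^ 2 ≤ v * (M * R.Phi n p) :=
      (mul_le_mul_of_nonneg_right hp (by positivity)).trans hv
    rw [← hκκ] at h1
    have h2 : M * ((κ * μ) ^ 2) ≤ M * (v * R.Phi n p) := by linarith
    exact le_of_mul_le_mul_left h2 hM
  have hσ0 : 0 < √v := lt_of_lt_of_le (by positivity) hσ
  have hv0 : 0 < v := Real.sqrt_pos.1 hσ0
  set σ := √v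
  have hvσ : v = σ ^ 2 := (Real.sq_sqrt hv0.le).symm
  have hts : t * μ ≤ δ * σ := by
    calc t * μ = t * y * (μ / y) := by field_simp
      _ ≤ δ * κ * (μ / y) := by gcongr
      _ = δ * (κ * μ / y) := by ring
      _ ≤ δ * σ := by gcongr
  have hs : 0 < δ * σ := by positivity
  have hball := subsetExp_abs_centredSum_le_le hp0 hp1 (R.extImage (x := x)) (k := e)
    (D := C₀ * (μ / R.Phi n p)) (μ := μ) (fun φ => (R.card_extImage φ).le) (by
      rw [hμdef, R.autCard_mul_mean p x]
      simp [card_extImage]) (fun U hU => by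
      rw [hμdef, R.autCard_mul_mean p x]
      exact R.sum_meetWeight_extImage_le p x hn hΦ hU) hs
  rw [← hvdef] at hball
  set P := subsetExp (p : ℝ) (fun S => if |centredSum (p : ℝ) (R.extImage (x := x)) S| ≤ δ * σ
    then (1 : ℝ) else 0) with hP
  have hle : G(Fin n, p).real {Γ : SimpleGraph (Fin n) |
      |(R.extCount Γ x : ℝ) - R.mean n p| < t * R.mean n p} ≤ P := by
    rw [binomialRandom_real_eq]
    refine subsetExp_mono hp0 hp1 fun S => ?_
    simp only [abs_sub_mean_lt_iff]
    split_ifs with h1 h2 h2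
    · exact le_rfl
    · exact absurd (h1.le.trans hts) h2
    · exact zero_le_one
    · exact le_rfl
  refine hle.trans ?_
  have h1 : P ≤ 4 * δ + 48 * C₀ ^ 2 * μ ^ 3 / (δ * σ ^ 3 * y ^ 4) := by
    have h2 : σ ^ 2 * P ≤ 4 * (δ * σ) * σ + 48 / (δ * σ) * (μ * (C₀ * (μ / y ^ 2)) ^ 2) := by
      rw [← hyy, ← hvσ]; exact hball
    have h3 : 4 * (δ * σ) * σ + 48 / (δ * σ) * (μ * (C₀ * (μ / y ^ 2)) ^ 2) =
        σ ^ 2 * (4 * δ + 48 * C₀ ^ 2 * μ ^ 3 / (δ * σ ^ 3 * y ^ 4)) := by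
      field_simp
    rw [h3] at h2
    exact le_of_mul_le_mul_left h2 (by positivity)
  refine h1.trans ?_
  gcongr 4 * δ + ?_
  calc 48 * C₀ ^ 2 * μ ^ 3 / (δ * σ ^ 3 * y ^ 4) ≤
        48 * C₀ ^ 2 * μ ^ 3 / (δ * (κ * μ / y) ^ 3 * y ^ 4) := by gcongr
    _ = _ := by field_simp

/-- The probability that an extension count is far from its mean. -/
theorem binomialRandom_le_abs_sub_mean_le
    (hE : R.rootGraph.edgeSet.ncard < R.graph.edgeSet.ncard) (k : ℕ) :
    ∃ C : ℝ, 0 < C ∧ ∀ (n : ℕ) (p : unitInterval) (x : Fin r ↪ Fin n) (t : ℝ),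
      2 * Nat.card V ≤ n → 1 ≤ R.Phi n p → 0 < t →
      G(Fin n, p).real {Γ : SimpleGraph (Fin n) |
        ¬ |(R.extCount Γ x : ℝ) - R.mean n p| < t * R.mean n p} ≤
        C / (t ^ 2 * R.Phi n p) ^ k := by
  classical
  set e := R.extEdges.card
  -- In the 2k-th moment, the exposed set can consist of up to 2k images of e edges each.
  set C₀ := R.overlapConst (2 * k * e)
  have hC₀ : 0 < C₀ := zero_lt_one.trans_le (R.one_le_overlapConst _)
  refine ⟨2 ^ (2 * k) * (2 * k).factorial * C₀ ^ (2 * k), by positivity, ?_⟩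
  intro n p x t hn hΦ1 ht
  have hΦ : 0 < R.Phi n p := zero_lt_one.trans_le hΦ1
  have hp0 : (0 : ℝ) ≤ p := p.2.1
  have hp1 : (p : ℝ) ≤ 1 := p.2.2
  have hμ := R.mean_pos_of_Phi_pos hE p x hn hΦ
  set μ := R.autCard * R.mean n p with hμdef
  set y := √(R.Phi n p)
  have hy : 1 ≤ y := Real.one_le_sqrt.2 hΦ1
  have hy0 : 0 < y := zero_lt_one.trans_le hy
  have hyy : R.Phi n p = y ^ 2 := (Real.sq_sqrt hΦ.le).symm
  -- With D = C₀μ/Φ, the choice b = C₀μ/√Φ satisfies D ≤ b because Φ ≥ 1, and μD ≤ b² because C₀ ≥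
  -- 1.
  have hmom := subsetExp_centredSum_pow_le hp0 hp1 (R.extImage (x := x)) (k := e)
    (D := C₀ * (μ / R.Phi n p)) (μ := μ) (b := C₀ * (μ / y)) (fun φ => (R.card_extImage φ).le)
    (by positivity)
    (by
      rw [hyy]
      gcongr
      nlinarith)
    (by
      rw [hyy]
      calc μ * (C₀ * (μ / y ^ 2)) = C₀ * (μ / y) ^ 2 := by field_simp
        _ ≤ C₀ ^ 2 * (μ / y) ^ 2 := by
          gcongr
          exact le_self_pow₀ (R.one_le_overlapConst _) two_ne_zero
        _ = _ := by ring)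
    (by
      rw [hμdef, R.autCard_mul_mean p x]
      simp [card_extImage]) (2 * k) (fun U hU => by
      rw [hμdef, R.autCard_mul_mean p x]
      exact R.sum_meetWeight_extImage_le p x hn hΦ hU)
  have htail := subsetExp_abs_ge_le hp0 hp1 (centredSum (p : ℝ) (R.extImage (x := x)))
    (mul_pos ht hμ) k
  rw [binomialRandom_real_eq]
  simp only [abs_sub_mean_lt_iff, not_lt]
  refine htail.trans ?_
  calc _ ≤ 2 ^ (2 * k) * ((2 * k).factorial * (C₀ * (μ / y)) ^ (2 * k)) / (t * μ) ^ (2 * k) := by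
        gcongr
    _ = 2 ^ (2 * k) * (2 * k).factorial * C₀ ^ (2 * k) / (t * y) ^ (2 * k) := by
        rw [mul_pow C₀, div_pow, mul_pow t μ, mul_pow t y]
        field_simp
    _ = _ := by
        rw [hyy, ← mul_pow t y, ← pow_mul]

end SingleRoot

end RootedGraph

/-! ### The two limits, from the estimates for a single root -/

theorem theorem4 {V : Type u} [Finite V] {r : ℕ} (R : RootedGraph V r)
    (hE : R.rootGraph.edgeSet.ncard < R.graph.edgeSet.ncard)
    (p : ℕ → unitInterval) (ε : ℕ → ℝ) (hε : ∀ n, 0 < ε n ∧ ε n ≤ 1)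
    (hp : ∃ c : ℝ, 0 < c ∧ ∀ᶠ n : ℕ in atTop, c ≤ 1 - (p n : ℝ))
    (hΦ : Tendsto (fun n : ℕ => R.Phi n (p n)) atTop atTop) :
    (Tendsto (fun n : ℕ => ε n ^ 2 * R.Phi n (p n)) atTop (𝓝 0) →
      Tendsto (fun n : ℕ => G(Fin n, p n).real {Γ : SimpleGraph (Fin n) |
          ∀ x : Fin r ↪ Fin n,
            |(R.extCount Γ x : ℝ) - R.mean n (p n)| < ε n * R.mean n (p n)})
        atTop (𝓝 0)) ∧
    ((∃ c : ℝ, 0 < c ∧ ∀ᶠ n : ℕ in atTop, (n : ℝ) ^ c ≤ ε n ^ 2 * R.Phi n (p n)) →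
      Tendsto (fun n : ℕ => G(Fin n, p n).real {Γ : SimpleGraph (Fin n) |
          ∀ x : Fin r ↪ Fin n,
            |(R.extCount Γ x : ℝ) - R.mean n (p n)| < ε n * R.mean n (p n)})
        atTop (𝓝 1)) := by
  have hrV : r ≤ Nat.card V := by
    cases nonempty_fintype V
    rw [Nat.card_eq_fintype_card]; simpa using Fintype.card_le_of_embedding R.root
  have hΦ1 : ∀ᶠ n : ℕ in atTop, 1 ≤ R.Phi n (p n) := hΦ.eventually_ge_atTop 1
  have hbig : ∀ᶠ n : ℕ in atTop, 2 * Nat.card V ≤ n := eventually_ge_atTop _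
  constructor
  · intro h0
    obtain ⟨c, hc, hpc⟩ := hp
    obtain ⟨κ, C, hκ, hC, hball⟩ := R.binomialRandom_abs_sub_mean_lt_le hE hc
    rw [Metric.tendsto_atTop']
    intro η hη
    -- With δ = η/8 the main term 4δ is η/2, and the other term is eventually below η/2.
    have hδ : 0 < η / 8 := by positivity
    have hy : Tendsto (fun n : ℕ => C / (η / 8 * √(R.Phi n (p n)))) atTop (𝓝 0) :=
      tendsto_const_nhds.div_atTop
        ((Real.tendsto_sqrt_atTop.comp hΦ).const_mul_atTop hδ)
    have h1 : ∀ᶠ n : ℕ in atTop, C / (η / 8 * √(R.Phi n (p n))) < η / 2 :=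
      hy.eventually_lt_const (by positivity)
    have h2 : ∀ᶠ n : ℕ in atTop, ε n ^ 2 * R.Phi n (p n) < (η / 8 * κ) ^ 2 :=
      h0.eventually_lt_const (by positivity)
    have hev := ((hpc.and hΦ1).and hbig).and (h1.and h2)
    obtain ⟨m, hm⟩ := eventually_atTop.1 hev
    refine ⟨m, fun n hn => ?_⟩
    obtain ⟨⟨⟨hpn, hΦn⟩, hVn⟩, h1n, h2n⟩ := hm n hn.le
    have hΦ0 : 0 < R.Phi n (p n) := zero_lt_one.trans_le hΦn
    rw [Real.dist_0_eq_abs, abs_of_nonneg measureReal_nonneg]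
    have hεy : ε n * √(R.Phi n (p n)) ≤ η / 8 * κ := by
      refine (pow_le_pow_iff_left₀ (by have := (hε n).1; positivity) (by positivity) two_ne_zero).1 ?_
      rw [mul_pow, Real.sq_sqrt hΦ0.le]
      exact h2n.le
    -- The event for all roots is contained in the event for any one of them.
    let x : Fin r ↪ Fin n := Fin.castLEEmb (by omega)
    refine (measureReal_mono (Set.ofPred_subset_ofPred.2 fun Γ hΓ => hΓ x)).trans_lt
      ((hball n (p n) x (ε n) (η / 8) hVn hpn hΦ0 hδ hεy).trans_lt ?_)
    linarith
  · rintro ⟨c, hc, hcn⟩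
    -- This makes (ε²Φ)^k at least n^(r+1), so the union bound over at most n^r roots leaves C/n.
    obtain ⟨k, hk⟩ := exists_nat_gt ((r + 1 : ℝ) / c)
    rw [div_lt_iff₀ hc] at hk
    obtain ⟨C, hC, htail⟩ := R.binomialRandom_le_abs_sub_mean_le hE k
    have hlim : Tendsto (fun n : ℕ => 1 - C / (n : ℝ)) atTop (𝓝 1) := by
      have := (tendsto_const_div_atTop_nhds_zero_nat C).const_sub 1
      rwa [sub_zero] at this
    refine tendsto_of_tendsto_of_tendsto_of_le_of_le' hlim tendsto_const_nhds ?_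
      (Eventually.of_forall fun n => measureReal_le_one)
    filter_upwards [hcn, hΦ1, hbig, eventually_ge_atTop 1] with n hn hΦn hVn hn1
    have hn0 : (0 : ℝ) < n := by exact_mod_cast hn1
    have hn1' : (1 : ℝ) ≤ n := by exact_mod_cast hn1
    have hcompl : {Γ : SimpleGraph (Fin n) | ∀ x : Fin r ↪ Fin n,
        |(R.extCount Γ x : ℝ) - R.mean n (p n)| < ε n * R.mean n (p n)}ᶜ =
        ⋃ x : Fin r ↪ Fin n, {Γ : SimpleGraph (Fin n) |
          ¬ |(R.extCount Γ x : ℝ) - R.mean n (p n)| < ε n * R.mean n (p n)} := by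
      ext Γ
      simp
    have hadd := probReal_add_probReal_compl (μ := G(Fin n, p n)) (s := {Γ : SimpleGraph (Fin n) |
      ∀ x : Fin r ↪ Fin n, |(R.extCount Γ x : ℝ) - R.mean n (p n)| < ε n * R.mean n (p n)})
      (Set.toFinite _).measurableSet
    have hpow : (n : ℝ) ^ (r + 1) ≤ (ε n ^ 2 * R.Phi n (p n)) ^ k := by
      calc (n : ℝ) ^ (r + 1) = (n : ℝ) ^ ((r + 1 : ℕ) : ℝ) := (Real.rpow_natCast _ _).symm
        _ ≤ (n : ℝ) ^ (c * k) := by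
          refine Real.rpow_le_rpow_of_exponent_le hn1' ?_
          push_cast
          linarith
        _ = ((n : ℝ) ^ c) ^ k := Real.rpow_mul_natCast hn0.le c k
        _ ≤ _ := by gcongr
    have hbound : G(Fin n, p n).real (⋃ x : Fin r ↪ Fin n, {Γ : SimpleGraph (Fin n) |
        ¬ |(R.extCount Γ x : ℝ) - R.mean n (p n)| < ε n * R.mean n (p n)}) ≤ C / n := by
      refine (measureReal_iUnion_fintype_le _).trans ?_
      refine (Finset.sum_le_card_nsmul _ _ _ fun x _ =>
        htail n (p n) x (ε n) hVn hΦn (hε n).1).trans ?_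
      have hcard : (Fintype.card (Fin r ↪ Fin n) : ℝ) ≤ (n : ℝ) ^ r := by
        rw [Fintype.card_embedding_eq, Fintype.card_fin, Fintype.card_fin]
        exact_mod_cast Nat.descFactorial_le_pow n r
      rw [Finset.card_univ, nsmul_eq_mul]
      calc _ ≤ (n : ℝ) ^ r * (C / (n : ℝ) ^ (r + 1)) := by gcongr
        _ = C / n := by rw [pow_succ]; field_simp
    rw [hcompl] at hadd
    linarith
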